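/- **Theorem 5.15.** Let $k$ be a field, $Q$ a finite quiver (finitely many vertices and arrows), and $C=kQ^c$ its path coalgebra: the $k$-space with basis all paths, with $\Delta(p)=\sum_{p=xy}x\otimes y$ and $\varepsilon(p)=1$ if $p$ is one of the trivial paths $e_i$ ($i\in Q_0$), $\varepsilon(p)=0$ otherwise. Let $A=C^*$ be the dual algebra with the convolution product (the complete path algebra), let $D\subseteq C$ be a large subcoalgebra, i.e. one containing all paths of length $\le 1$, and let $B=D^*=A/D^\perp$, where $D^\perp=\{f\in A\mid f(D)=0\}$. Notation. For $\sigma\in\mathrm{Aut}(D)$ (coalgebra automorphisms) let $\sigma^*\in\mathrm{Aut}(B)$ ($k$-algebra automorphisms) be its transpose $f\mapsto f\circ\sigma$. Let $D_{(0)}$ be the coradical of $D$ and $D_+$ the intersection of $D$ with the span of the nontrivial paths; put $\mathrm{Aut}_0(D)=\{\sigma\in\mathrm{Aut}(D)\mid \sigma|_{D_{(0)}}=\mathrm{id}\}$ and $\mathrm{Aut}_\bullet(D)=\{\sigma\in\mathrm{Aut}_0(D)\mid\sigma(D_+)\subseteq D_+\}$. Let $\overline{e_i}\in B$ be the functional giving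 the coefficient of $e_i$, let $B_0\subseteq B$ be the span of the $\overline{e_i}$ (a subalgebra, the image of $A_0=\bigoplus_i k\,\overline{e_i}\subseteq A$), and let $\mathrm{rad}(B)$ be the Jacobson radical. For $b\in B^\times$ put $\chi_b(x)=bxb^{-1}$, and set $\mathrm{Inn}(B)=\chi(B^\times)$, $\mathrm{Inn}_\circ(B)=\chi(1+\mathrm{rad}(B))$, $\mathrm{Inn}_0(B)=\chi(B_0^\times)$, $\mathrm{Out}(B)=\mathrm{Aut}(B)/\mathrm{Inn}(B)$, $Z_B^\times(B_0)=\{a\in B^\times\mid ab=ba\ \forall b\in B_0\}$, $\mathrm{Aut}_0(B)=\{\sigma\in\mathrm{Aut}(B)\mid\sigma(\overline{e_i})\in\overline{e_i}+\mathrm{rad}(B)\ \forall i\in Q_0\}$ and $\mathrm{Aut}_\bullet(B)=\{\sigma\in\mathrm{Aut}(B)\mid\sigma|_{B_0}=\mathrm{id}\}$. Semidirect products are internal ones of subgroups of $\mathrm{Aut}(B)$, the normal factor being the left one. Then: 1. $\{\sigma^*\mid\sigma\in\mathrm{Aut}_0(D)\}=\mathrm{Aut}_0(B)$. 2. $\{\sigma^*\mid\sigma\in\mathrm{Aut}_\bullet(D)\}=\mathrm{Aut}_\bullet(B)$.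 3. $\mathrm{Inn}(B)$ and $\mathrm{Inn}_\circ(B)$ are normal in $\mathrm{Aut}(B)$, and $\mathrm{Inn}(B)=\mathrm{Inn}_\circ(B)\rtimes\mathrm{Inn}_0(B)$. 4. $\mathrm{Aut}_0(B)=\mathrm{Inn}_\circ(B)\cdot\mathrm{Aut}_\bullet(B)$ and $\mathrm{Inn}(B)\cap\mathrm{Aut}_\bullet(B)=\chi(Z_B^\times(B_0))$. If in addition $Z_B^\times(B_0)=B_0^\times$, then $\mathrm{Aut}_0(B)=\mathrm{Inn}_\circ(B)\rtimes\mathrm{Aut}_\bullet(B)$. 5. $\chi(Z_B^\times(B_0))$ is normal in $\mathrm{Aut}_\bullet(B)$, $\mathrm{Aut}_0(B)$ is normal in $\mathrm{Aut}(B)$, and the natural maps form an exact sequence of groups $$1\longrightarrow \mathrm{Aut}_\bullet(B)/\chi(Z_B^\times(B_0))\longrightarrow \mathrm{Out}(B)\longrightarrow\mathrm{Aut}(B)/\mathrm{Aut}_0(B)\longrightarrow 1 .$$ -/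

import Mathlib

open scoped TensorProduct Pointwise

universe u v w

noncomputable section

namespace PathCoalg

/-! ### Subcoalgebras and the coradical -/

section Subcoalgebras

theorem map_subtype_injective {k : Type u} [Field k] {C : Type v} [AddCommGroup C] [Module k C]
    (S : Submodule k C) :
    Function.Injective (TensorProduct.map S.subtype S.subtype) :=
  TensorProduct.map_injective_of_flat_flat _ _ S.injective_subtype S.injective_subtype

variable (k : Type u) [Field k] (C : Type v) [AddCommGroup C] [Module k C] [Coalgebra k C]

/-- A subcoalgebra of `C`: a subspace `S` with `Δ(S) ⊆ S ⊗ S`. -/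
structure Subcoalgebra extends Submodule k C where
  comul_mem' : ∀ x ∈ carrier, Coalgebra.comul (R := k) x ∈
    LinearMap.range (TensorProduct.map toSubmodule.subtype toSubmodule.subtype)

variable {k C}

/-- The underlying space of a subcoalgebra. -/
abbrev Subcoalgebra.Carrier (S : Subcoalgebra k C) : Type v := S.toSubmodule

/-- A subcoalgebra is simple if it is nonzero and has no subcoalgebra other than `0` and itself. -/
def Subcoalgebra.IsSimple (S : Subcoalgebra k C) : Prop :=
  S.toSubmodule ≠ ⊥ ∧
    ∀ T : Subcoalgebra k C, T.toSubmodule ≤ S.toSubmodule →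
      T.toSubmodule = ⊥ ∨ T.toSubmodule = S.toSubmodule

variable (k C) in
/-- The coradical: the sum of all simple subcoalgebras. -/
def coradical : Submodule k C :=
  ⨆ (S : Subcoalgebra k C) (_ : S.IsSimple), S.toSubmodule

/-- The comultiplication of `C` restricted to a subcoalgebra. -/
def Subcoalgebra.comul (S : Subcoalgebra k C) :
    S.Carrier →ₗ[k] S.Carrier ⊗[k] S.Carrier :=
  (LinearEquiv.ofInjective _ (map_subtype_injective S.toSubmodule)).symm.toLinearMap ∘ₗ
    LinearMap.codRestrict _ (Coalgebra.comul ∘ₗ S.toSubmodule.subtype)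
      (fun x => S.comul_mem' x x.2)

theorem Subcoalgebra.map_comul (S : Subcoalgebra k C) (x : S.Carrier) :
    TensorProduct.map S.toSubmodule.subtype S.toSubmodule.subtype (S.comul x) =
      Coalgebra.comul (R := k) (x : C) := by
  have h := LinearEquiv.apply_symm_apply
    (LinearEquiv.ofInjective _ (map_subtype_injective S.toSubmodule))
    (LinearMap.codRestrict _ (Coalgebra.comul ∘ₗ S.toSubmodule.subtype)
      (fun x => S.comul_mem' x x.2) x)
  exact congrArg Subtype.val h

theorem Subcoalgebra.map_comp_comul (S : Subcoalgebra k C) :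
    TensorProduct.map S.toSubmodule.subtype S.toSubmodule.subtype ∘ₗ S.comul =
      Coalgebra.comul ∘ₗ S.toSubmodule.subtype :=
  LinearMap.ext S.map_comul

/-- A subcoalgebra with the restricted comultiplication and counit. -/
instance Subcoalgebra.instCoalgebra (S : Subcoalgebra k C) : Coalgebra k S.Carrier where
  comul := S.comul
  counit := Coalgebra.counit ∘ₗ S.toSubmodule.subtype
  coassoc := by
    set i := S.toSubmodule.subtype with hi
    have hinj : Function.Injective (TensorProduct.map i (TensorProduct.map i i)) :=
      TensorProduct.map_injective_of_flat_flat _ _ S.toSubmodule.injective_subtype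
        (map_subtype_injective S.toSubmodule)
    ext x
    apply hinj
    have h1 : ∀ z : (S.Carrier ⊗[k] S.Carrier),
        TensorProduct.map i (TensorProduct.map i i)
          (TensorProduct.assoc k _ _ _ (S.comul.rTensor _ z)) =
        TensorProduct.assoc k C C C
          ((Coalgebra.comul (R := k)).rTensor C (TensorProduct.map i i z)) := by
      intro z
      induction z with
      | zero => simp
      | add a b ha hb => simp only [map_add, ha, hb]
      | tmul a b =>
        simp only [LinearMap.rTensor_tmul, TensorProduct.map_tmul]
        have hc : Coalgebra.comul (R := k) (i a) = TensorProduct.map i i (S.comul a) :=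
          (S.map_comul a).symm
        rw [hc]
        induction S.comul a with
        | zero => simp
        | add a b ha hb => simp only [map_add, ha, hb, TensorProduct.add_tmul]
        | tmul c d => simp
    have h2 : ∀ z : (S.Carrier ⊗[k] S.Carrier),
        TensorProduct.map i (TensorProduct.map i i) (S.comul.lTensor _ z) =
          (Coalgebra.comul (R := k)).lTensor C (TensorProduct.map i i z) := by
      intro z
      induction z with
      | zero => simp
      | add a b ha hb => simp only [map_add, ha, hb]
      | tmul a b =>
        simp only [LinearMap.lTensor_tmul, TensorProduct.map_tmul]
        congr 1
        exact S.map_comul b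
    have hm : TensorProduct.map i i (S.comul x) = Coalgebra.comul (R := k) (x : C) := S.map_comul x
    simp only [LinearMap.comp_apply, LinearEquiv.coe_coe]
    rw [h1, h2, hm, Coalgebra.coassoc_apply]
  rTensor_counit_comp_comul := by
    set i := S.toSubmodule.subtype with hi
    have hinj : Function.Injective (i.lTensor k) :=
      Module.Flat.lTensor_preserves_injective_linearMap _ S.toSubmodule.injective_subtype
    ext x
    apply hinj
    have h1 : ∀ z : (S.Carrier ⊗[k] S.Carrier),
        i.lTensor k ((Coalgebra.counit ∘ₗ i).rTensor _ z) =
          (Coalgebra.counit (R := k)).rTensor C (TensorProduct.map i i z) := by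
      intro z
      induction z with
      | zero => simp
      | add a b ha hb => simp only [map_add, ha, hb]
      | tmul a b => simp
    have hm : TensorProduct.map i i (S.comul x) = Coalgebra.comul (R := k) (x : C) := S.map_comul x
    simp only [LinearMap.comp_apply]
    rw [h1, hm, Coalgebra.rTensor_counit_comul]
    simp [hi]
  lTensor_counit_comp_comul := by
    set i := S.toSubmodule.subtype with hi
    have hinj : Function.Injective (i.rTensor k) :=
      Module.Flat.rTensor_preserves_injective_linearMap _ S.toSubmodule.injective_subtype
    ext x
    apply hinj
    have h1 : ∀ z : (S.Carrier ⊗[k] S.Carrier),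
        i.rTensor k ((Coalgebra.counit ∘ₗ i).lTensor _ z) =
          (Coalgebra.counit (R := k)).lTensor C (TensorProduct.map i i z) := by
      intro z
      induction z with
      | zero => simp
      | add a b ha hb => simp only [map_add, ha, hb]
      | tmul a b => simp
    have hm : TensorProduct.map i i (S.comul x) = Coalgebra.comul (R := k) (x : C) := S.map_comul x
    simp only [LinearMap.comp_apply]
    rw [h1, hm, Coalgebra.lTensor_counit_comul]
    simp [hi]

/-- The inclusion of a subcoalgebra. -/
def Subcoalgebra.incl (S : Subcoalgebra k C) : S.Carrier →ₗc[k] C where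
  toLinearMap := S.toSubmodule.subtype
  counit_comp := rfl
  map_comp_comul := S.map_comp_comul

end Subcoalgebras

/-! ### Dual algebras -/

section Dual

variable (k : Type u) [Field k]

/-- The dual algebra `C^*` of a coalgebra: linear functionals with the convolution product
`(f * g)(c) = ∑ f(c₁) g(c₂)` and unit the counit. -/
abbrev DualAlg (C : Type v) [AddCommGroup C] [Module k C] [Coalgebra k C] : Type (max u v) :=
  WithConv (C →ₗ[k] k)

variable {k} {C : Type v} [AddCommGroup C] [Module k C] [Coalgebra k C]
  {D : Type w} [AddCommGroup D] [Module k D] [Coalgebra k D]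

/-- The transpose `h^* : D^* → C^*`, `f ↦ f ∘ h`, of a coalgebra map `h : C → D`. -/
def dualMap (h : C →ₗc[k] D) : DualAlg k D →ₐ[k] DualAlg k C :=
  AlgHom.ofLinearMap
    { toFun := fun f => WithConv.toConv (f.ofConv ∘ₗ h.toLinearMap)
      map_add' := fun _ _ => rfl
      map_smul' := fun _ _ => rfl }
    (by
      ext x
      exact congrArg (fun l : C →ₗ[k] k => l x) h.counit_comp)
    (fun f g => by
      ext x
      exact congrArg (fun l : C →ₗ[k] k => l x)
        (LinearMap.convMul_comp_coalgHom_distrib f g h))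

@[simp] theorem dualMap_apply (h : C →ₗc[k] D) (f : DualAlg k D) (x : C) :
    dualMap h f x = f (h x) := rfl

/-- The transpose `σ^*` of a coalgebra automorphism, as an automorphism of the dual algebra. -/
def dualAut (σ : C ≃ₗc[k] C) : DualAlg k C ≃ₐ[k] DualAlg k C :=
  AlgEquiv.ofAlgHom (dualMap (σ : C →ₗc[k] C)) (dualMap (σ.symm : C →ₗc[k] C))
    (by ext f x; exact congrArg f.ofConv (σ.symm_apply_apply x))
    (by ext f x; exact congrArg f.ofConv (σ.apply_symm_apply x))

@[simp] theorem dualAut_apply (σ : C ≃ₗc[k] C) (f : DualAlg k C) (x : C) :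
    dualAut σ f x = f (σ x) := rfl

/-- The restriction `C^* → S^*` to a subcoalgebra `S`. It is onto with kernel `S^⊥`, which is
the identification `S^* = C^*/S^⊥`. -/
def Subcoalgebra.res (S : Subcoalgebra k C) : DualAlg k C →ₐ[k] DualAlg k S.Carrier :=
  dualMap S.incl

theorem Subcoalgebra.res_surjective (S : Subcoalgebra k C) : Function.Surjective S.res := by
  intro f
  obtain ⟨g, hg⟩ := LinearMap.exists_extend f.ofConv
  exact ⟨WithConv.toConv g, WithConv.ext hg⟩

theorem Subcoalgebra.mem_ker_res (S : Subcoalgebra k C) (f : DualAlg k C) :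
    f ∈ RingHom.ker S.res ↔ ∀ x ∈ S.toSubmodule, f x = 0 := by
  rw [RingHom.mem_ker]
  constructor
  · intro h x hx
    exact congrArg (fun l : DualAlg k S.Carrier => l ⟨x, hx⟩) h
  · intro h
    ext x
    exact h x x.2

end Dual

/-! ### Path coalgebras -/

section Path

/-- The set of all paths of a quiver, including the trivial ones. -/
structure QPath (V : Type v) [Quiver.{w} V] : Type (max v w) where
  {src : V}
  {tgt : V}
  path : Quiver.Path src tgt

/-- The trivial path at `i`. -/
def QPath.triv {V : Type v} [Quiver.{w} V] (i : V) : QPath V := QPath.mk (Quiver.Path.nil (a := i))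

/-- The length of a path. -/
def QPath.length {V : Type v} [Quiver.{w} V] (p : QPath V) : ℕ := p.path.length

/-- All the ways `p = x y` to split a path in two. -/
def splits {V : Type v} [Quiver.{w} V] {i : V} :
    ∀ {j : V}, Quiver.Path i j → List (Σ m : V, Quiver.Path i m × Quiver.Path m j)
  | _, .nil => [⟨i, .nil, .nil⟩]
  | j, .cons p a => ⟨j, .cons p a, .nil⟩ :: (splits p).map fun t => ⟨t.1, t.2.1, t.2.2.cons a⟩

/-- The list `splits p` holds exactly the pairs `(x, y)` with `x y = p`. -/
theorem mem_splits {V : Type v} [Quiver.{w} V] {i j : V} (p : Quiver.Path i j)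
    (t : Σ m : V, Quiver.Path i m × Quiver.Path m j) :
    t ∈ splits p ↔ t.2.1.comp t.2.2 = p := by
  induction p with
  | nil =>
    obtain ⟨m, x, y⟩ := t
    cases y with
    | nil =>
      simp only [splits, List.mem_singleton, Quiver.Path.comp_nil]
      constructor
      · intro h
        cases h
        rfl
      · intro h
        subst h
        rfl
    | cons y a =>
      simp only [splits, List.mem_singleton, Quiver.Path.comp_cons]
      constructor
      · intro h
        obtain ⟨rfl, h⟩ := Sigma.mk.inj_iff.mp h
        have h' := congrArg (fun q => q.2.length) (eq_of_heq h)
        simp at h'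
      · intro h
        have h' := congrArg Quiver.Path.length h
        simp at h'
  | cons p a ih =>
    obtain ⟨m, x, y⟩ := t
    cases y with
    | nil =>
      simp only [splits, List.mem_cons, List.mem_map, Quiver.Path.comp_nil]
      constructor
      · rintro (h | ⟨t, -, h⟩)
        · cases h
          rfl
        · obtain ⟨rfl, h⟩ := Sigma.mk.inj_iff.mp h
          have h' := congrArg (fun q => q.2.length) (eq_of_heq h)
          simp at h'
      · intro h
        subst h
        exact Or.inl rfl
    | cons y b =>
      simp only [splits, List.mem_cons, List.mem_map, Quiver.Path.comp_cons]
      constructor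
      · rintro (h | ⟨t, ht, h⟩)
        · obtain ⟨rfl, h⟩ := Sigma.mk.inj_iff.mp h
          have h' := congrArg (fun q => q.2.length) (eq_of_heq h)
          simp at h'
        · obtain ⟨t1, t2, t3⟩ := t
          cases h
          rw [(ih _).mp ht]
      · intro h
        cases h
        exact Or.inr ⟨⟨m, x, y⟩, (ih _).mpr rfl, rfl⟩

theorem nodup_splits {V : Type v} [Quiver.{w} V] {i j : V} (p : Quiver.Path i j) :
    (splits p).Nodup := by
  induction p with
  | nil => simp [splits]
  | cons p a ih =>
    rw [splits, List.nodup_cons]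
    refine ⟨?_, ih.map ?_⟩
    · rw [List.mem_map]
      rintro ⟨t, -, h⟩
      obtain ⟨h1, h⟩ := Sigma.mk.inj_iff.mp h
      obtain ⟨t1, t2, t3⟩ := t
      dsimp only at h1
      subst h1
      have h' := congrArg (fun q => q.2.length) (eq_of_heq h)
      simp at h'
    · rintro ⟨m, x, y⟩ ⟨m', x', y'⟩ h
      cases h
      rfl

theorem sum_splits_assoc {V : Type v} [Quiver.{w} V] {M : Type*} [AddCommMonoid M] {i j : V}
    (p : Quiver.Path i j)
    (F : ∀ m n : V, Quiver.Path i m → Quiver.Path m n → Quiver.Path n j → M) :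
    ((splits p).map fun t => ((splits t.2.1).map fun s => F s.1 t.1 s.2.1 s.2.2 t.2.2).sum).sum =
    ((splits p).map fun t => ((splits t.2.2).map fun s => F t.1 s.1 t.2.1 s.2.1 s.2.2).sum).sum := by
  induction p with
  | nil => simp [splits]
  | cons p a ih =>
    simp only [splits, List.map_cons, List.map_map, List.sum_cons, Function.comp_def,
      List.map_nil, List.sum_nil, add_zero]
    rw [ih (fun m n x y z => F m n x y (z.cons a)), List.sum_map_add]
    abel

variable (k : Type u) [Field k] (V : Type v) [Quiver.{w} V]

/-- The path coalgebra: the vector space with basis all paths. -/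
def PathCoalgebra : Type (max u v w) := QPath V →₀ k

instance : AddCommGroup (PathCoalgebra k V) := inferInstanceAs (AddCommGroup (QPath V →₀ k))
instance : Module k (PathCoalgebra k V) := inferInstanceAs (Module k (QPath V →₀ k))

variable {V}

/-- A path as a basis element of the path coalgebra. -/
def ofPath (p : QPath V) : PathCoalgebra k V := Finsupp.single p (1 : k)

variable {k} in
/-- The coefficient of the path `p`, as a linear functional; this is `p` read as an element of
the complete path algebra. -/
def coeff (p : QPath V) : PathCoalgebra k V →ₗ[k] k := Finsupp.lapply p

variable {k} in
theorem hom_ext_path {M : Type*} [AddCommGroup M] [Module k M] {f g : PathCoalgebra k V →ₗ[k] M}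
    (h : ∀ p, f (ofPath k p) = g (ofPath k p)) : f = g :=
  Finsupp.lhom_ext' fun p => LinearMap.ext_ring (h p)

/-- `Δ(p) = ∑ x ⊗ y` over all splittings `p = x y`. -/
def comulPath (p : QPath V) : PathCoalgebra k V ⊗[k] PathCoalgebra k V :=
  ((splits p.path).map fun t => ofPath k (QPath.mk t.2.1) ⊗ₜ[k] ofPath k (QPath.mk t.2.2)).sum

/-- The comultiplication of the path coalgebra. -/
def pathComul : PathCoalgebra k V →ₗ[k] PathCoalgebra k V ⊗[k] PathCoalgebra k V :=
  Finsupp.linearCombination k (comulPath k)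

/-- The counit: `1` on trivial paths, `0` on the nontrivial ones. -/
def pathCounit : PathCoalgebra k V →ₗ[k] k :=
  Finsupp.linearCombination k fun p : QPath V => if p.length = 0 then (1 : k) else 0

theorem pathComul_ofPath (p : QPath V) : pathComul k (ofPath k p) = comulPath k p := by
  unfold pathComul ofPath
  erw [Finsupp.linearCombination_single]
  exact one_smul _ _

theorem pathCounit_ofPath (p : QPath V) :
    pathCounit k (ofPath k p) = if p.length = 0 then (1 : k) else 0 := by
  unfold pathCounit ofPath
  erw [Finsupp.linearCombination_single]
  exact one_smul _ _

theorem coeff_ofPath [DecidableEq (QPath V)] (p q : QPath V) :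
    coeff p (ofPath k q) = if q = p then (1 : k) else 0 := by
  unfold coeff ofPath
  erw [Finsupp.lapply_apply]
  exact Finsupp.single_apply

theorem left_counit_sum {i j : V} (p : Quiver.Path i j) :
    ((splits p).map fun t => pathCounit k (ofPath k (QPath.mk t.2.1)) ⊗ₜ[k]
      ofPath k (QPath.mk t.2.2)).sum = (1 : k) ⊗ₜ[k] ofPath k (QPath.mk p) := by
  suffices h : ∀ {M : Type (max u v w)} [AddCommGroup M] [Module k M]
      (F : ∀ m : V, Quiver.Path m j → M),
      ((splits p).map fun t => pathCounit k (ofPath k (QPath.mk t.2.1)) • F t.1 t.2.2).sum =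
        F i p by
    have := h (M := k ⊗[k] PathCoalgebra k V) (fun m y => (1 : k) ⊗ₜ[k] ofPath k (QPath.mk y))
    rw [← this]
    congr 2
    funext t
    rw [TensorProduct.smul_tmul', smul_eq_mul, mul_one]
  induction p with
  | nil =>
    intro M _ _ F
    simp [splits, pathCounit_ofPath, QPath.length]
  | cons p a ih =>
    intro M _ _ F
    simp only [splits, List.map_cons, List.map_map, List.sum_cons, Function.comp_def]
    rw [ih (fun m y => F m (y.cons a))]
    simp [pathCounit_ofPath, QPath.length]

theorem right_counit_sum {i j : V} (p : Quiver.Path i j) :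
    ((splits p).map fun t => ofPath k (QPath.mk t.2.1) ⊗ₜ[k]
      pathCounit k (ofPath k (QPath.mk t.2.2))).sum = ofPath k (QPath.mk p) ⊗ₜ[k] (1 : k) := by
  cases p with
  | nil => simp [splits, pathCounit_ofPath, QPath.length]
  | cons p a =>
    simp [splits, pathCounit_ofPath, QPath.length, Function.comp_def]

theorem map_list_sum {M N ι : Type*} [AddCommMonoid M] [AddCommMonoid N] [Module k M] [Module k N]
    (f : M →ₗ[k] N) (l : List ι) (g : ι → M) :
    f ((l.map g).sum) = (l.map fun x => f (g x)).sum := by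
  rw [_root_.map_list_sum, List.map_map]
  rfl

instance : Coalgebra k (PathCoalgebra k V) where
  comul := pathComul k
  counit := pathCounit k
  coassoc := by
    apply hom_ext_path
    rintro ⟨p⟩
    simp only [LinearMap.comp_apply, LinearEquiv.coe_coe, pathComul_ofPath, comulPath]
    rw [← LinearEquiv.coe_coe, map_list_sum, map_list_sum, map_list_sum]
    simp only [LinearMap.rTensor_tmul, LinearMap.lTensor_tmul, pathComul_ofPath, comulPath]
    have h := sum_splits_assoc p (fun m n x y z =>
      ofPath k (QPath.mk x) ⊗ₜ[k] (ofPath k (QPath.mk y) ⊗ₜ[k] ofPath k (QPath.mk z)))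
    convert h using 3
    · funext t
      have h1 := map_list_sum k ((TensorProduct.assoc k (PathCoalgebra k V) (PathCoalgebra k V)
        (PathCoalgebra k V)).toLinearMap ∘ₗ
        (TensorProduct.mk k _ _).flip (ofPath k (QPath.mk t.2.2))) (splits t.2.1)
        (fun s => ofPath k (QPath.mk s.2.1) ⊗ₜ[k] ofPath k (QPath.mk s.2.2))
      simpa using h1
    · funext t
      have h1 := map_list_sum k (TensorProduct.mk k (PathCoalgebra k V) _
        (ofPath k (QPath.mk t.2.1))) (splits t.2.2)
        (fun s => ofPath k (QPath.mk s.2.1) ⊗ₜ[k] ofPath k (QPath.mk s.2.2))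
      simpa using h1
  rTensor_counit_comp_comul := by
    apply hom_ext_path
    rintro ⟨p⟩
    simp only [LinearMap.comp_apply, pathComul_ofPath, comulPath]
    rw [map_list_sum]
    exact left_counit_sum k p
  lTensor_counit_comp_comul := by
    apply hom_ext_path
    rintro ⟨p⟩
    simp only [LinearMap.comp_apply, pathComul_ofPath, comulPath]
    rw [map_list_sum]
    exact right_counit_sum k p

variable (V) in
/-- The span of the paths whose length lies in `s`. -/
def lengthSpan (s : Set ℕ) : Submodule k (PathCoalgebra k V) :=
  Submodule.span k (ofPath k '' {p : QPath V | p.length ∈ s})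

variable {k}

/-- A subcoalgebra of the path coalgebra is large if it contains all paths of length at most 1. -/
def IsLarge (D : Subcoalgebra k (PathCoalgebra k V)) : Prop :=
  lengthSpan k V (Set.Iic 1) ≤ D.toSubmodule

/-- `D₊`, the part of `D` spanned by nontrivial paths, as a subspace of `D`. -/
def plusPart (D : Subcoalgebra k (PathCoalgebra k V)) : Submodule k D.Carrier :=
  (lengthSpan k V (Set.Ici 1)).comap D.toSubmodule.subtype

/-- `Aut₀(D)`: the coalgebra automorphisms that fix the coradical pointwise. -/
def coalgAutZero (D : Subcoalgebra k (PathCoalgebra k V)) :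
    Set (D.Carrier ≃ₗc[k] D.Carrier) :=
  {σ | ∀ x ∈ coradical k D.Carrier, σ x = x}

/-- `Aut_•(D)`: the elements of `Aut₀(D)` that map `D₊` into itself. -/
def coalgAutBullet (D : Subcoalgebra k (PathCoalgebra k V)) :
    Set (D.Carrier ≃ₗc[k] D.Carrier) :=
  {σ | σ ∈ coalgAutZero D ∧ ∀ x ∈ plusPart D, σ x ∈ plusPart D}

/-- The idempotent of the complete path algebra given by the trivial path at `i`. -/
def idem (i : V) : DualAlg k (PathCoalgebra k V) := WithConv.toConv (coeff (QPath.triv i))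

variable (k V) in
/-- The degree zero part `A₀` of the complete path algebra: the combinations `∑ aᵢ eᵢ`, that is,
the functionals that vanish on all nontrivial paths. -/
def degZero : Subalgebra k (DualAlg k (PathCoalgebra k V)) where
  carrier := {f | ∀ p : QPath V, 0 < p.length → f (ofPath k p) = 0}
  add_mem' {f g} hf hg p hp := by
    have h : (f + g) (ofPath k p) = f (ofPath k p) + g (ofPath k p) := rfl
    rw [h, hf p hp, hg p hp, add_zero]
  mul_mem' {f g} hf hg p hp := by
    rw [LinearMap.convMul_apply]
    have h : Coalgebra.comul (R := k) (ofPath k p) = comulPath k p := pathComul_ofPath k p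
    rw [h, comulPath, map_list_sum, map_list_sum]
    apply List.sum_eq_zero
    intro x hx
    rw [List.mem_map] at hx
    obtain ⟨t, ht, rfl⟩ := hx
    rw [mem_splits] at ht
    have hl : t.2.1.length + t.2.2.length = p.length := by
      rw [← Quiver.Path.length_comp, ht]
      rfl
    rw [TensorProduct.map_tmul, LinearMap.mul'_apply]
    rcases Nat.eq_zero_or_pos t.2.1.length with h0 | h0
    · exact mul_eq_zero_of_right _ (hg (QPath.mk t.2.2) (by change 0 < t.2.2.length; omega))
    · exact mul_eq_zero_of_left (hf (QPath.mk t.2.1) h0) _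
  algebraMap_mem' r p hp := by
    rw [LinearMap.convAlgebraMap_apply]
    have h : Coalgebra.counit (R := k) (ofPath k p) = 0 := by
      refine (pathCounit_ofPath k p).trans (if_neg hp.ne')
    rw [h, map_zero, smul_zero]

theorem degZero_eq_span [Finite V] :
    Subalgebra.toSubmodule (degZero k V) = Submodule.span k (Set.range (idem (k := k) (V := V))) := by
  classical
  have hval : ∀ (i : V) (q : QPath V), (idem (k := k) i) (ofPath k q) =
      if q = QPath.triv i then (1 : k) else 0 := fun i q => coeff_ofPath k _ _
  apply le_antisymm
  · intro f hf
    cases nonempty_fintype V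
    have : f = ∑ i, f (ofPath k (QPath.triv i)) • idem i := by
      apply WithConv.ext
      apply hom_ext_path
      rintro q
      have hs : (∑ i, f (ofPath k (QPath.triv i)) • idem (k := k) i).ofConv (ofPath k q) =
          ∑ i, f (ofPath k (QPath.triv i)) * (idem (k := k) i) (ofPath k q) := by
        have h1 := map_sum (WithConv.linearEquiv k (PathCoalgebra k V →ₗ[k] k))
          (fun i => f (ofPath k (QPath.triv i)) • idem (k := k) i) Finset.univ
        have h2 := congrArg (fun l : PathCoalgebra k V →ₗ[k] k => l (ofPath k q)) h1
        rw [LinearMap.sum_apply] at h2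
        exact h2
      rw [hs]
      simp only [hval]
      obtain ⟨p⟩ := q
      rename_i i j
      cases p with
      | nil =>
        rw [Finset.sum_eq_single i]
        · exact ((congrArg _ (if_pos rfl)).trans (mul_one _)).symm
        · intro b _ hb
          rw [if_neg, mul_zero]
          intro h
          exact hb (congrArg QPath.src h).symm
        · intro h
          exact absurd (Finset.mem_univ i) h
      | cons p a =>
        rw [Finset.sum_eq_zero]
        · exact hf _ (Nat.succ_pos _)
        · intro b _
          rw [if_neg, mul_zero]
          intro h
          have := congrArg QPath.length h
          simp [QPath.length, QPath.triv] at this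
    rw [this]
    exact Submodule.sum_mem _ fun i _ => Submodule.smul_mem _ _ (Submodule.subset_span ⟨i, rfl⟩)
  · rw [Submodule.span_le]
    rintro _ ⟨i, rfl⟩ q hq
    rw [hval, if_neg]
    rintro rfl
    exact absurd hq (by simp [QPath.length, QPath.triv])

end Path

/-! ### Automorphism groups of algebras -/

section Alg

variable (k : Type u) [Field k] (B : Type v) [Ring B] [Algebra k B]

/-- `χ : Bˣ → Aut(B)`, `χ_b(x) = b x b⁻¹`. -/
def chi : Bˣ →* (B ≃ₐ[k] B) where
  toFun b :=
    AlgEquiv.ofAlgHom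
      (AlgHom.ofLinearMap
        (LinearMap.mulLeft k (b : B) ∘ₗ LinearMap.mulRight k ((b⁻¹ : Bˣ) : B))
        (by simp) (fun x y => by simp [mul_assoc]))
      (AlgHom.ofLinearMap
        (LinearMap.mulLeft k ((b⁻¹ : Bˣ) : B) ∘ₗ LinearMap.mulRight k (b : B))
        (by simp) (fun x y => by simp [mul_assoc]))
      (by ext x; simp [mul_assoc]) (by ext x; simp [mul_assoc])
  map_one' := by ext x; simp
  map_mul' a b := by ext x; simp [mul_assoc]

@[simp] theorem chi_apply (b : Bˣ) (x : B) : chi k B b x = b * x * ((b⁻¹ : Bˣ) : B) := by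
  simp [chi, mul_assoc]

/-- The group `Inn(B)` of inner automorphisms. -/
def inn : Subgroup (B ≃ₐ[k] B) := (chi k B).range

/-- The group `1 + rad(B)`, where `rad` is the Jacobson radical. -/
def oneAddRad : Subgroup Bˣ where
  carrier := {b | (b : B) - 1 ∈ Ring.jacobson B}
  mul_mem' {a b} ha hb := by
    have h : ((a * b : Bˣ) : B) - 1 = (a : B) * ((b : B) - 1) + ((a : B) - 1) := by
      rw [Units.val_mul]
      noncomm_ring
    change ((a * b : Bˣ) : B) - 1 ∈ Ring.jacobson B
    rw [h]
    exact add_mem (Ideal.mul_mem_left _ _ hb) ha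
  one_mem' := by simp
  inv_mem' {a} ha := by
    have h : ((a⁻¹ : Bˣ) : B) - 1 = -(((a⁻¹ : Bˣ) : B) * ((a : B) - 1)) := by
      rw [mul_sub, Units.inv_mul]
      noncomm_ring
    change ((a⁻¹ : Bˣ) : B) - 1 ∈ Ring.jacobson B
    rw [h]
    exact neg_mem (Ideal.mul_mem_left _ _ ha)

/-- Every element of `1 + rad(B)` is a unit, so that `oneAddRad` is all of `1 + rad(B)`. -/
theorem exists_oneAddRad {r : B} (hr : r ∈ Ring.jacobson B) :
    ∃ b ∈ oneAddRad B, (b : B) = 1 + r := by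
  have key : ∀ s ∈ Ring.jacobson B, ∃ t, t * (1 + s) = 1 := by
    intro s hs
    rw [← Ideal.jacobson_bot] at hs
    obtain ⟨z, hz⟩ := Ideal.mem_jacobson_iff.mp hs 1
    refine ⟨z, ?_⟩
    rw [mul_one, Ideal.mem_bot] at hz
    rw [mul_add, mul_one, add_comm]
    exact sub_eq_zero.mp hz
  obtain ⟨t, ht⟩ := key r hr
  obtain ⟨t', ht'⟩ := key (-(t * r)) (neg_mem (Ideal.mul_mem_left _ _ hr))
  have h1 : 1 + -(t * r) = t := by
    rw [mul_add, mul_one] at ht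
    rw [← ht]
    abel
  rw [h1] at ht'
  have h2 : (1 + r) * t = 1 := by
    have : t' = 1 + r := by
      calc t' = t' * (t * (1 + r)) := by rw [ht, mul_one]
        _ = 1 + r := by rw [← mul_assoc, ht', one_mul]
    rw [← this, ht']
  exact ⟨⟨1 + r, t, h2, ht⟩, by simpa [oneAddRad] using hr, rfl⟩

/-- `Inn_∘(B) = χ(1 + rad(B))`. -/
def innCirc : Subgroup (B ≃ₐ[k] B) := (oneAddRad B).map (chi k B)

variable {k B}

/-- The group `Sˣ` of invertible elements of a subalgebra `S`, inside `Bˣ`. -/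
def unitsOf (S : Subalgebra k B) : Subgroup Bˣ := S.toSubmonoid.units

/-- The centralizer of `S` in `Bˣ`. -/
def centralizerUnits (S : Subalgebra k B) : Subgroup Bˣ where
  carrier := {a | ∀ b ∈ S, (a : B) * b = b * a}
  mul_mem' {a c} ha hc b hb := by
    rw [Units.val_mul, mul_assoc, hc b hb, ← mul_assoc, ha b hb, mul_assoc]
  one_mem' b _ := by simp
  inv_mem' {a} ha b hb := by
    rw [Units.inv_mul_eq_iff_eq_mul, ← mul_assoc, ha b hb, mul_assoc, Units.mul_inv, mul_one]

/-- `χ(Sˣ)`; for `S = B₀` this is `Inn₀(B)`. -/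
def innOf (S : Subalgebra k B) : Subgroup (B ≃ₐ[k] B) := (unitsOf S).map (chi k B)

/-- The automorphisms that fix `S` pointwise; for `S = B₀` this is `Aut_•(B)`. -/
def autFixing (S : Subalgebra k B) : Subgroup (B ≃ₐ[k] B) where
  carrier := {σ | ∀ b ∈ S, σ b = b}
  mul_mem' {σ τ} hσ hτ b hb := by rw [AlgEquiv.mul_apply, hτ b hb, hσ b hb]
  one_mem' _ _ := rfl
  inv_mem' {σ} hσ b hb := by
    change σ.symm b = b
    rw [AlgEquiv.symm_apply_eq, hσ b hb]

theorem map_mem_jacobson (σ : B ≃ₐ[k] B) {x : B} (hx : x ∈ Ring.jacobson B) :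
    σ x ∈ Ring.jacobson B := by
  have : RingHomSurjective (σ : B →+* B) := ⟨σ.surjective⟩
  exact Ring.map_jacobson_le (σ : B →+* B) ⟨x, hx, rfl⟩

/-- The automorphisms `σ` with `σ(eᵢ) ∈ eᵢ + rad(B)` for all `i`. -/
def autModRad {ι : Type*} (e : ι → B) : Subgroup (B ≃ₐ[k] B) where
  carrier := {σ | ∀ i, σ (e i) - e i ∈ Ring.jacobson B}
  mul_mem' {σ τ} hσ hτ i := by
    have h : (σ * τ) (e i) - e i = σ (τ (e i) - e i) + (σ (e i) - e i) := by
      rw [AlgEquiv.mul_apply, map_sub]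
      abel
    rw [h]
    exact add_mem (map_mem_jacobson σ (hτ i)) (hσ i)
  one_mem' i := by simp
  inv_mem' {σ} hσ i := by
    have h : σ⁻¹ (e i) - e i = -(σ.symm (σ (e i) - e i)) := by
      rw [map_sub, AlgEquiv.symm_apply_apply]
      change σ.symm (e i) - e i = _
      abel
    rw [h]
    exact neg_mem (map_mem_jacobson σ.symm (hσ i))

/-- `G = N ⋊ H` as an internal semidirect product of subgroups of an ambient group. -/
structure IsInternalSemidirect {Γ : Type*} [Group Γ] (G N H : Subgroup Γ) : Prop where
  left_le : N ≤ G
  right_le : H ≤ G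
  normal : (N.subgroupOf G).Normal
  disjoint : N ⊓ H = ⊥
  mul_eq : (N : Set Γ) * (H : Set Γ) = (G : Set Γ)

end Alg

/-! ### The groups attached to the dual algebra of a subcoalgebra of the path coalgebra -/

section Quot

variable {k : Type u} [Field k] {V : Type v} [Quiver.{w} V]
  (D : Subcoalgebra k (PathCoalgebra k V))

/-- `B = D^*`, identified with `A/D^⊥` through `D.res`. -/
abbrev BAlg : Type (max u v w) := DualAlg k D.Carrier

/-- The group `Aut(B)` of `k`-algebra automorphisms of `B`. -/
abbrev AutB : Type (max u v w) := BAlg D ≃ₐ[k] BAlg D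

/-- `B₀`, the image of `A₀` in `B = D^*`. -/
def bZero : Subalgebra k (BAlg D) := (degZero k V).map D.res

/-- `Inn₀(B) = χ(B₀ˣ)`. -/
def innZero : Subgroup (AutB D) := innOf (bZero D)

/-- `Aut₀(B)`: the automorphisms with `σ(eᵢ) ∈ eᵢ + rad(B)` for every vertex `i`. -/
def autZero : Subgroup (AutB D) :=
  autModRad fun i : V => D.res (idem i)

/-- `Aut_•(B)`: the automorphisms that restrict to the identity on `B₀`. -/
def autBullet : Subgroup (AutB D) := autFixing (bZero D)

/-- `χ(Z)`, where `Z` is the centralizer of `B₀` in `Bˣ`. -/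
def chiCentralizer : Subgroup (AutB D) :=
  (centralizerUnits (bZero D)).map (chi k (BAlg D))

end Quot

end PathCoalg

end

open PathCoalg

/-!
The radical of `B = D^*` is the annihilator of the trivial paths: evaluation at a trivial path is
an algebra map to `k`, and a functional `1 - F` with `F` zero on the trivial paths is inverted by
the geometric series, which is finite on each path. Hence `B = B₀ ⊕ rad(B)` with `B₀ ≅ k^V`
(`radicalSplitting`), and the statements about inner automorphisms, `Aut₀(B)` and the exact sequence
hold for every algebra that splits in this way over its radical. The two facts they rest on are:

* an automorphism `φ` that is the identity modulo the radical agrees on the idempotents `eᵢ` with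
  conjugation by `b = ∑ φ(eᵢ) eᵢ ∈ 1 + rad(B)` (`RadicalSplitting.exists_chi_e_eq`);
* `Inn_∘(B)` and `Inn₀(B)` meet trivially, because the degree zero part of a central element is
  central: a central element takes equal values at the two ends of each arrow, and `D` contains all
  arrows (`lift_proj_commute`).

The comparison with the coalgebra holds because every automorphism `φ` of `B` is the transpose of a
coalgebra automorphism (`dualAut_surjective`). Indeed, as the quiver is finite, a functional that
vanishes on the paths of length at most `n` is a finite sum of products of a functional that
vanishes on those of length less than `n` with the coefficient of an arrow, which is in the radical;
by induction `φ` preserves the annihilators of the finite-dimensional steps of the length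
filtration (`VanishesBelow.exists_map`), so each `f ↦ φ(f)(x)` is evaluation at a point of `D`.
Finally the coradical of `D` is spanned by the trivial paths (`coradical_eq_span`), so that the
conditions that define `Aut₀` and `Aut_•` on the two sides correspond.
-/

noncomputable section

namespace PathCoalg

/-! ### Algebras that split over their radical with quotient a power of the field -/

/-- A splitting of `B` over its Jacobson radical as `k^ι ⊕ rad(B)`: an algebra map `proj` onto
`k^ι` with kernel `rad(B)`, together with an algebra section `lift`. -/
structure RadicalSplitting (k : Type*) [Field k] (ι : Type*) (B : Type*) [Ring B]
    [Algebra k B] where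
  proj : B →ₐ[k] (ι → k)
  lift : (ι → k) →ₐ[k] B
  proj_lift : ∀ u, proj (lift u) = u
  mem_jacobson_iff : ∀ b, b ∈ Ring.jacobson B ↔ proj b = 0

section Inner

variable {k : Type*} [Field k] {B : Type*} [Ring B] [Algebra k B]

theorem conj_chi (σ : B ≃ₐ[k] B) (b : Bˣ) :
    σ * chi k B b * σ⁻¹ = chi k B (Units.map (σ : B →* B) b) := by
  ext x
  have h : σ (σ⁻¹ x) = x := σ.apply_symm_apply x
  simp only [AlgEquiv.mul_apply, chi_apply, map_mul, h]
  rfl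

theorem inn_normal : (inn k B).Normal := by
  constructor
  rintro _ ⟨b, rfl⟩ σ
  exact ⟨_, (conj_chi σ b).symm⟩

theorem innCirc_normal : (innCirc k B).Normal := by
  constructor
  rintro _ ⟨b, hb, rfl⟩ σ
  refine ⟨_, ?_, (conj_chi σ b).symm⟩
  have h : (b : B) - 1 ∈ Ring.jacobson B := hb
  have h' := map_mem_jacobson σ h
  rw [map_sub, map_one] at h'
  exact h'

theorem innCirc_le_inn : innCirc k B ≤ inn k B := by
  rintro _ ⟨b, -, rfl⟩
  exact ⟨b, rfl⟩

theorem chi_eq_iff (a b : Bˣ) :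
    chi k B a = chi k B b ↔ ∀ x : B, Commute ((a⁻¹ * b : Bˣ) : B) x := by
  rw [← inv_mul_eq_one, ← map_inv, ← map_mul]
  refine ⟨fun h x => ?_, fun h => ?_⟩
  · have hx := congrArg (fun τ : B ≃ₐ[k] B => τ x) h
    simp only [chi_apply, AlgEquiv.one_apply] at hx
    exact (Units.mul_inv_eq_iff_eq_mul _).mp hx
  · ext x
    simp only [chi_apply, AlgEquiv.one_apply]
    exact (Units.mul_inv_eq_iff_eq_mul _).mpr (h x)

theorem inn_inf_autFixing (S : Subalgebra k B) :
    inn k B ⊓ autFixing S = (centralizerUnits S).map (chi k B) := by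
  ext τ
  constructor
  · rintro ⟨⟨b, rfl⟩, hb⟩
    refine ⟨b, fun x hx => ?_, rfl⟩
    have h : chi k B b x = x := hb x hx
    rw [chi_apply] at h
    exact (Units.mul_inv_eq_iff_eq_mul _).mp h
  · rintro ⟨b, hb, rfl⟩
    refine ⟨⟨b, rfl⟩, fun x hx => ?_⟩
    rw [chi_apply]
    exact (Units.mul_inv_eq_iff_eq_mul _).mpr (hb x hx)

end Inner

namespace RadicalSplitting

variable {k : Type*} [Field k] {ι : Type*} {B : Type*} [Ring B] [Algebra k B]
  (R : RadicalSplitting k ι B)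

theorem sub_mem_jacobson_iff (a b : B) : a - b ∈ Ring.jacobson B ↔ R.proj a = R.proj b := by
  rw [R.mem_jacobson_iff, map_sub, sub_eq_zero]

theorem mem_oneAddRad (b : Bˣ) : b ∈ oneAddRad B ↔ R.proj b = 1 := by
  rw [← map_one R.proj]
  exact R.sub_mem_jacobson_iff b 1

theorem proj_chi (b : Bˣ) (x : B) : R.proj (chi k B b x) = R.proj x := by
  rw [chi_apply, map_mul, map_mul, mul_right_comm, ← map_mul, Units.mul_inv, map_one, one_mul]

/-- The unit `lift (proj b)`, the component in `k^ι` of a unit `b`. -/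
def unitLift (b : Bˣ) : Bˣ := Units.map (R.lift.comp R.proj : B →* B) b

theorem coe_unitLift (b : Bˣ) : (R.unitLift b : B) = R.lift (R.proj b) := rfl

theorem unitLift_mem (b : Bˣ) : R.unitLift b ∈ unitsOf R.lift.range := by
  refine (Submonoid.mem_units_iff _ _).mpr ⟨⟨_, rfl⟩, ?_⟩
  rw [unitLift, ← map_inv]
  exact ⟨_, rfl⟩

theorem unitLift_eq_self {c : Bˣ} (hc : c ∈ unitsOf R.lift.range) : R.unitLift c = c := by
  obtain ⟨u, hu⟩ : (c : B) ∈ R.lift.range := ((Submonoid.mem_units_iff _ _).mp hc).1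
  ext
  rw [coe_unitLift, ← hu]
  exact congrArg R.lift (R.proj_lift u)

/-- The two groups meet trivially if the `k^ι`-component of each central unit is central. -/
theorem innCirc_inf_innOf
    (hR : ∀ z : Bˣ, (∀ x : B, Commute (z : B) x) → ∀ x, Commute (R.lift (R.proj z)) x) :
    innCirc k B ⊓ innOf R.lift.range = ⊥ := by
  rw [eq_bot_iff]
  rintro _ ⟨⟨b, hb, rfl⟩, ⟨c, hc, hbc⟩⟩
  have hz := hR _ ((chi_eq_iff b c).mp hbc.symm)
  -- `c = b z` with `z` central, and `b` is `1` modulo the radical, so `c = lift (proj z)`.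
  have hcz : R.lift (R.proj ((b⁻¹ * c : Bˣ) : B)) = c := by
    have hb' : R.proj ((b⁻¹ : Bˣ) : B) = 1 := (R.mem_oneAddRad _).mp (inv_mem hb)
    rw [Units.val_mul, map_mul, hb', one_mul, ← coe_unitLift, R.unitLift_eq_self hc]
  rw [hcz] at hz
  rw [Subgroup.mem_bot, ← hbc, ← map_one (chi k B), eq_comm, chi_eq_iff, inv_one, one_mul]
  exact hz

theorem inn_isInternalSemidirect
    (hR : ∀ z : Bˣ, (∀ x : B, Commute (z : B) x) → ∀ x, Commute (R.lift (R.proj z)) x) :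
    IsInternalSemidirect (inn k B) (innCirc k B) (innOf R.lift.range) where
  left_le := innCirc_le_inn
  right_le := by
    rintro _ ⟨b, -, rfl⟩
    exact ⟨b, rfl⟩
  normal := innCirc_normal.subgroupOf _
  disjoint := R.innCirc_inf_innOf hR
  mul_eq := by
    apply Set.Subset.antisymm
    · rintro _ ⟨_, ⟨b, -, rfl⟩, _, ⟨c, -, rfl⟩, rfl⟩
      exact ⟨b * c, map_mul _ _ _⟩
    · rintro _ ⟨b, rfl⟩
      refine ⟨chi k B (b * (R.unitLift b)⁻¹), ⟨_, ?_, rfl⟩, chi k B (R.unitLift b),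
        ⟨_, R.unitLift_mem b, rfl⟩, ?_⟩
      · have h : R.proj ((R.unitLift b : Bˣ) : B) = R.proj (b : B) := R.proj_lift _
        refine (R.mem_oneAddRad _).mpr ?_
        rw [Units.val_mul, map_mul, ← h, ← map_mul, Units.mul_inv, map_one]
      · change chi k B _ * chi k B _ = _
        rw [← map_mul, inv_mul_cancel_right]

variable [DecidableEq ι]

/-- The idempotent of `B` that corresponds to the `i`-th standard idempotent of `k^ι`. -/
def e (i : ι) : B := R.lift (Pi.single i 1)

theorem e_mul_e_self (i : ι) : R.e i * R.e i = R.e i := by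
  rw [e, ← map_mul, ← Pi.single_mul, one_mul]

theorem e_mul_e_of_ne {i j : ι} (h : i ≠ j) : R.e i * R.e j = 0 := by
  rw [e, e, ← map_mul]
  convert map_zero R.lift
  ext l
  by_cases hl : l = i
  · subst hl
    simp [h]
  · simp [hl]

variable [Fintype ι]

theorem lift_eq_sum (a : ι → k) : R.lift a = ∑ i, a i • R.e i := by
  conv_lhs => rw [pi_eq_sum_univ' a]
  rw [map_sum]
  refine Finset.sum_congr rfl fun i _ => ?_
  rw [map_smul, e]

theorem sum_e : ∑ i, R.e i = 1 := by
  rw [← map_one R.lift, R.lift_eq_sum]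
  simp

theorem mem_autFixing_iff (τ : B ≃ₐ[k] B) :
    τ ∈ autFixing R.lift.range ↔ ∀ i, τ (R.e i) = R.e i := by
  refine ⟨fun h i => h _ ⟨_, rfl⟩, ?_⟩
  rintro h _ ⟨a, rfl⟩
  change τ (R.lift a) = R.lift a
  rw [R.lift_eq_sum, map_sum]
  exact Finset.sum_congr rfl fun i _ => by rw [map_smul, h]

/-- An automorphism lies in `Aut₀(B)` exactly when it induces the identity on `B/rad(B)`. -/
theorem mem_autModRad_iff (τ : B ≃ₐ[k] B) :
    τ ∈ autModRad R.e ↔ ∀ x, R.proj (τ x) = R.proj x := by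
  refine ⟨fun h x => ?_, fun h i => (R.sub_mem_jacobson_iff _ _).mpr (h _)⟩
  have h1 : R.proj (τ (R.lift (R.proj x))) = R.proj x := by
    conv_rhs => rw [← R.proj_lift (R.proj x)]
    rw [R.lift_eq_sum, map_sum, map_sum, map_sum]
    refine Finset.sum_congr rfl fun i _ => ?_
    rw [map_smul, map_smul, map_smul, (R.sub_mem_jacobson_iff _ _).mp (h i)]
  have h2 : x - R.lift (R.proj x) ∈ Ring.jacobson B := by
    rw [R.sub_mem_jacobson_iff, R.proj_lift]
  have h3 := map_mem_jacobson τ h2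
  rw [map_sub, R.sub_mem_jacobson_iff] at h3
  rw [h3, h1]

theorem autModRad_normal : (autModRad (k := k) R.e).Normal := by
  constructor
  intro τ hτ σ
  rw [R.mem_autModRad_iff] at hτ ⊢
  intro x
  have h := map_mem_jacobson σ ((R.sub_mem_jacobson_iff _ _).mpr (hτ (σ⁻¹ x)))
  rw [map_sub, R.sub_mem_jacobson_iff] at h
  rw [AlgEquiv.mul_apply, AlgEquiv.mul_apply, h]
  exact congrArg R.proj (σ.apply_symm_apply x)

theorem inn_le_autModRad : inn k B ≤ autModRad R.e := by
  rintro _ ⟨b, rfl⟩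
  exact (R.mem_autModRad_iff _).mpr (R.proj_chi b)

theorem autFixing_le_autModRad : autFixing R.lift.range ≤ autModRad R.e := by
  intro τ hτ i
  rw [(R.mem_autFixing_iff τ).mp hτ i, sub_self]
  exact zero_mem _

/-- If `φ` is the identity modulo the radical, then `b = ∑ φ(eᵢ) eᵢ` lies in `1 + rad(B)` and
conjugation by `b` agrees with `φ` on the `eᵢ`. -/
theorem exists_chi_e_eq {φ : B ≃ₐ[k] B} (hφ : φ ∈ autModRad R.e) :
    ∃ b ∈ oneAddRad B, ∀ i, chi k B b (R.e i) = φ (R.e i) := by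
  set s : B := ∑ i, φ (R.e i) * R.e i with hs
  have hproj : R.proj s = R.proj 1 := by
    rw [hs, ← R.sum_e, map_sum, map_sum]
    refine Finset.sum_congr rfl fun i _ => ?_
    rw [map_mul, (R.mem_autModRad_iff φ).mp hφ, ← map_mul, e_mul_e_self]
  obtain ⟨b, hb, hbs⟩ := exists_oneAddRad B ((R.sub_mem_jacobson_iff s 1).mpr hproj)
  rw [add_sub_cancel] at hbs
  refine ⟨b, hb, fun i => ?_⟩
  rw [chi_apply, Units.mul_inv_eq_iff_eq_mul, hbs, hs, Finset.sum_mul, Finset.mul_sum]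
  rw [Finset.sum_eq_single i, Finset.sum_eq_single i]
  · rw [mul_assoc, e_mul_e_self, ← mul_assoc, ← map_mul, e_mul_e_self]
  · intro j _ hj
    rw [← mul_assoc, ← map_mul, R.e_mul_e_of_ne hj.symm, map_zero, zero_mul]
  · simp
  · intro j _ hj
    rw [mul_assoc, R.e_mul_e_of_ne hj, mul_zero]
  · simp

theorem autModRad_eq_mul :
    (autModRad (k := k) R.e : Set (B ≃ₐ[k] B)) =
      (innCirc k B : Set (B ≃ₐ[k] B)) * (autFixing R.lift.range : Set (B ≃ₐ[k] B)) := by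
  apply Set.Subset.antisymm
  · intro φ hφ
    obtain ⟨b, hb, h⟩ := R.exists_chi_e_eq hφ
    refine ⟨chi k B b, ⟨b, hb, rfl⟩, (chi k B b)⁻¹ * φ, ?_, mul_inv_cancel_left _ _⟩
    refine (R.mem_autFixing_iff _).mpr fun i => ?_
    rw [AlgEquiv.mul_apply, ← h]
    exact (chi k B b).symm_apply_apply _
  · rintro _ ⟨σ, hσ, τ, hτ, rfl⟩
    exact mul_mem (R.inn_le_autModRad (innCirc_le_inn hσ)) (R.autFixing_le_autModRad hτ)

theorem autModRad_isInternalSemidirect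
    (hR : ∀ z : Bˣ, (∀ x : B, Commute (z : B) x) → ∀ x, Commute (R.lift (R.proj z)) x)
    (hZ : centralizerUnits R.lift.range = unitsOf R.lift.range) :
    IsInternalSemidirect (autModRad (k := k) R.e) (innCirc k B) (autFixing R.lift.range) where
  left_le := innCirc_le_inn.trans R.inn_le_autModRad
  right_le := R.autFixing_le_autModRad
  normal := innCirc_normal.subgroupOf _
  disjoint := by
    have h := inn_inf_autFixing (k := k) R.lift.range
    rw [hZ] at h
    rw [eq_bot_iff, ← R.innCirc_inf_innOf hR]
    intro τ hτ
    exact ⟨hτ.1, h.le ⟨innCirc_le_inn hτ.1, hτ.2⟩⟩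
  mul_eq := R.autModRad_eq_mul.symm

end RadicalSplitting

/-- If `N ≤ M` are normal in `Γ` and `M = N H`, then `H/(N ∩ H)` is the kernel of `Γ/N → Γ/M`. -/
theorem exists_exact_quotient {Γ : Type*} [Group Γ] {N M H P : Subgroup Γ} (hN : N.Normal)
    (hM : M.Normal) (hNM : N ≤ M) (hHM : H ≤ M) (hP : N ⊓ H = P)
    (hmul : ∀ m ∈ M, ∃ n ∈ N, ∃ h ∈ H, n * h = m) :
    ∃ (_ : (P.subgroupOf H).Normal) (_ : N.Normal) (_ : M.Normal)
      (f : H ⧸ P.subgroupOf H →* Γ ⧸ N) (g : Γ ⧸ N →* Γ ⧸ M),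
      (∀ σ : H, f (QuotientGroup.mk σ) = QuotientGroup.mk (σ : Γ)) ∧
      (∀ σ : Γ, g (QuotientGroup.mk σ) = QuotientGroup.mk σ) ∧
      Function.Injective f ∧ f.range = g.ker ∧ Function.Surjective g := by
  have hPN : P.subgroupOf H = N.subgroupOf H := by
    ext x
    rw [Subgroup.mem_subgroupOf, Subgroup.mem_subgroupOf, ← hP]
    exact ⟨fun h => h.1, fun h => ⟨h, x.2⟩⟩
  have hPn : (P.subgroupOf H).Normal := hPN ▸ hN.subgroupOf H
  refine ⟨hPn, hN, hM, QuotientGroup.map _ N H.subtype hPN.le,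
    QuotientGroup.map N M (MonoidHom.id Γ) hNM, fun _ => rfl, fun _ => rfl, ?_, ?_, ?_⟩
  · rw [injective_iff_map_eq_one]
    intro x
    induction x using QuotientGroup.induction_on with | _ x
    intro hx
    rw [QuotientGroup.eq_one_iff, hPN]
    exact (QuotientGroup.eq_one_iff (N := N) (x : Γ)).mp hx
  · ext x
    constructor
    · rintro ⟨y, rfl⟩
      induction y using QuotientGroup.induction_on with | _ y
      exact (QuotientGroup.eq_one_iff (N := M) (y : Γ)).mpr (hHM y.2)
    · induction x using QuotientGroup.induction_on with | _ x
      intro hx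
      obtain ⟨n, hn, h, hh, rfl⟩ := hmul x ((QuotientGroup.eq_one_iff (N := M) x).mp hx)
      refine ⟨QuotientGroup.mk ⟨h, hh⟩, ?_⟩
      change (QuotientGroup.mk h : Γ ⧸ N) = QuotientGroup.mk n * QuotientGroup.mk h
      rw [(QuotientGroup.eq_one_iff n).mpr hn, one_mul]
  · intro y
    induction y using QuotientGroup.induction_on with | _ y
    exact ⟨QuotientGroup.mk y, rfl⟩

/-! ### Linear functionals and dual algebras -/

section LinearAlgebra

variable {k : Type*} [Field k] {C : Type*} [AddCommGroup C] [Module k C]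

/-- A functional on `S` that vanishes on `S ∩ W` extends to the whole space by one that vanishes
on `W`. -/
theorem exists_extend_of_vanishing {S W : Submodule k C} (f : S →ₗ[k] k)
    (hf : ∀ x : S, (x : C) ∈ W → f x = 0) :
    ∃ F : C →ₗ[k] k, F ∘ₗ S.subtype = f ∧ ∀ x ∈ W, F x = 0 := by
  have h : f ∈ (LinearMap.ker (W.mkQ ∘ₗ S.subtype)).dualAnnihilator := by
    rw [Submodule.mem_dualAnnihilator]
    intro x hx
    apply hf
    simpa using hx
  rw [← LinearMap.range_dualMap_eq_dualAnnihilator_ker] at h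
  obtain ⟨g, hg⟩ := h
  refine ⟨g ∘ₗ W.mkQ, hg, fun x hx => ?_⟩
  rw [LinearMap.comp_apply, Submodule.mkQ_apply, (Submodule.Quotient.mk_eq_zero W).mpr hx, map_zero]

/-- A functional on the dual space that kills the annihilator of a finite-dimensional subspace is
evaluation at a point. -/
theorem exists_eq_apply_of_vanishing (W : Submodule k C) [FiniteDimensional k W]
    (l : Module.Dual k C →ₗ[k] k) (hl : ∀ f : Module.Dual k C, (∀ x ∈ W, f x = 0) → l f = 0) :
    ∃ y : C, ∀ f, l f = f y := by
  obtain ⟨n, s, hs⟩ := Submodule.fg_iff_exists_fin_generating_family.mp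
    (Module.Finite.iff_fg.mp ‹FiniteDimensional k W›)
  have h : l ∈ Submodule.span k (Set.range fun i => Module.Dual.eval k C (s i)) := by
    refine mem_span_of_iInf_ker_le_ker fun f hf => hl f fun x hx => ?_
    have hW : W ≤ LinearMap.ker f := by
      rw [← hs, Submodule.span_le]
      rintro _ ⟨i, rfl⟩
      exact (Submodule.mem_iInf _).mp hf i
    exact hW hx
  rw [show (fun i => Module.Dual.eval k C (s i)) = Module.Dual.eval k C ∘ s from rfl,
    Set.range_comp, Submodule.span_image] at h
  obtain ⟨y, -, rfl⟩ := h
  exact ⟨y, fun _ => rfl⟩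

theorem eq_of_forall_dual_apply_eq {x y : C} (h : ∀ f : C →ₗ[k] k, f x = f y) : x = y := by
  rw [← sub_eq_zero, ← Module.forall_dual_apply_eq_zero_iff k]
  intro f
  rw [map_sub, h, sub_self]

/-- The products `f ⊗ g` of functionals separate the points of `C ⊗ C`. -/
theorem eq_of_forall_map_eq {z z' : C ⊗[k] C}
    (h : ∀ f g : C →ₗ[k] k, LinearMap.mul' k k (TensorProduct.map f g z) =
      LinearMap.mul' k k (TensorProduct.map f g z')) : z = z' := by
  let b := Module.Basis.ofVectorSpace k C
  apply (b.tensorProduct b).repr.injective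
  ext ⟨i, j⟩
  have key : ∀ z : C ⊗[k] C, (b.tensorProduct b).repr z (i, j) =
      LinearMap.mul' k k (TensorProduct.map (b.coord i) (b.coord j) z) := by
    intro z
    induction z with
    | zero => simp
    | add x y hx hy => simp only [map_add, Finsupp.add_apply, hx, hy]
    | tmul x y => simp [mul_comm]
  rw [key, key, h]

end LinearAlgebra

section DualAlg

variable {k : Type u} [Field k] {C : Type v} [AddCommGroup C] [Module k C] [Coalgebra k C]

theorem dualAlg_sum_apply {ι : Type*} (s : Finset ι) (f : ι → DualAlg k C) (x : C) :
    (∑ i ∈ s, f i) x = ∑ i ∈ s, f i x := by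
  rw [WithConv.ofConv_sum, LinearMap.sum_apply]

/-- Evaluation at a group-like element is an algebra homomorphism. -/
def evalGroupLike {x : C} (hx : IsGroupLikeElem k x) : DualAlg k C →ₐ[k] k :=
  AlgHom.ofLinearMap
    { toFun := fun f => f x
      map_add' := fun _ _ => rfl
      map_smul' := fun _ _ => rfl }
    (by
      change algebraMap k k (Coalgebra.counit x) = 1
      rw [hx.counit_eq_one, map_one])
    (fun f g => by
      change (f * g) x = f x * g x
      rw [LinearMap.convMul_apply, hx.comul_eq_tmul_self, TensorProduct.map_tmul,
        LinearMap.mul'_apply])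

theorem jacobson_apply_eq_zero {x : C} (hx : IsGroupLikeElem k x) {f : DualAlg k C}
    (hf : f ∈ Ring.jacobson (DualAlg k C)) : f x = 0 := by
  have hs : RingHomSurjective (evalGroupLike hx : DualAlg k C →+* k) :=
    ⟨fun c => ⟨algebraMap k _ c, (evalGroupLike hx).commutes c⟩⟩
  have h : evalGroupLike hx f ∈ Ring.jacobson k :=
    Ring.map_jacobson_le (evalGroupLike hx : DualAlg k C →+* k) ⟨f, hf, rfl⟩
  rwa [Ring.jacobson, IsSemisimpleModule.jacobson_eq_bot, Ideal.mem_bot] at h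

/-- The coalgebra map whose transpose is a given algebra endomorphism `φ` of the dual algebra.
It exists as soon as each functional `f ↦ φ(f)(x)` is the evaluation at a point. -/
theorem exists_dualMap_eq (φ : DualAlg k C →ₐ[k] DualAlg k C)
    (h : ∀ x, ∃ y, ∀ f, φ f x = f y) : ∃ σ : C →ₗc[k] C, dualMap σ = φ := by
  choose σ hσ using h
  have hσ' : ∀ (f : C →ₗ[k] k) x, f (σ x) = φ (WithConv.toConv f) x := fun f x =>
    (hσ x (WithConv.toConv f)).symm
  let s : C →ₗ[k] C :=
    { toFun := σ
      map_add' := fun x y => eq_of_forall_dual_apply_eq (k := k) fun f => by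
        rw [map_add, hσ', hσ', hσ']
        exact map_add (φ (WithConv.toConv f)).ofConv x y
      map_smul' := fun c x => eq_of_forall_dual_apply_eq (k := k) fun f => by
        rw [RingHom.id_apply, map_smul, hσ', hσ']
        exact map_smul (φ (WithConv.toConv f)).ofConv c x }
  have hs : ∀ f : C →ₗ[k] k, f ∘ₗ s = (φ (WithConv.toConv f)).ofConv := fun f =>
    LinearMap.ext (hσ' f)
  refine ⟨⟨s, ?_, ?_⟩, ?_⟩
  · ext x
    have h1 : φ 1 x = (1 : DualAlg k C) x := by rw [map_one]
    exact (hσ' _ x).trans h1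
  · ext x
    refine eq_of_forall_map_eq fun f g => ?_
    have h1 : (WithConv.toConv f * WithConv.toConv g) (s x) =
        (φ (WithConv.toConv f) * φ (WithConv.toConv g)) x := by
      rw [← map_mul]
      exact (hσ x _).symm
    rw [LinearMap.convMul_apply, LinearMap.convMul_apply, ← hs, ← hs,
      TensorProduct.map_comp] at h1
    exact h1.symm
  · ext f x
    exact (hσ x f).symm

theorem exists_dualAut_eq (φ : DualAlg k C ≃ₐ[k] DualAlg k C)
    (h : ∀ x, ∃ y, ∀ f, φ f x = f y) (h' : ∀ x, ∃ y, ∀ f, φ.symm f x = f y) :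
    ∃ σ : C ≃ₗc[k] C, dualAut σ = φ := by
  obtain ⟨σ, hσ⟩ := exists_dualMap_eq (φ : DualAlg k C →ₐ[k] DualAlg k C) h
  obtain ⟨τ, hτ⟩ := exists_dualMap_eq (φ.symm : DualAlg k C →ₐ[k] DualAlg k C) h'
  have hσ' : ∀ (f : DualAlg k C) x, f (σ x) = φ f x := fun f x =>
    congrArg (fun ψ : DualAlg k C →ₐ[k] DualAlg k C => ψ f x) hσ
  have hτ' : ∀ (f : DualAlg k C) x, f (τ x) = φ.symm f x := fun f x =>
    congrArg (fun ψ : DualAlg k C →ₐ[k] DualAlg k C => ψ f x) hτ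
  refine ⟨CoalgEquiv.ofCoalgHom σ τ ?_ ?_, ?_⟩
  · ext x
    refine eq_of_forall_dual_apply_eq (k := k) fun f => ?_
    have h1 := (hσ' (WithConv.toConv f) (τ x)).trans (hτ' _ x)
    rwa [AlgEquiv.symm_apply_apply] at h1
  · ext x
    refine eq_of_forall_dual_apply_eq (k := k) fun f => ?_
    have h1 := (hτ' (WithConv.toConv f) (σ x)).trans (hσ' _ x)
    rwa [AlgEquiv.apply_symm_apply] at h1
  · ext f x
    exact hσ' f x

end DualAlg

/-! ### The complete path algebra -/

section PathAlgebra

variable {k : Type u} [Field k] {V : Type v} [Quiver.{w} V]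

/-- The linear functional with prescribed values on the paths. -/
def pathFunctional (c : QPath V → k) : DualAlg k (PathCoalgebra k V) :=
  WithConv.toConv (Finsupp.linearCombination k c)

@[simp] theorem pathFunctional_ofPath (c : QPath V → k) (p : QPath V) :
    pathFunctional c (ofPath k p) = c p := by
  unfold pathFunctional ofPath
  erw [Finsupp.linearCombination_single]
  exact one_smul _ _

theorem dual_ext_path {F G : DualAlg k (PathCoalgebra k V)}
    (h : ∀ p, F (ofPath k p) = G (ofPath k p)) : F = G :=
  WithConv.ext (hom_ext_path h)

theorem conv_ofPath (F G : DualAlg k (PathCoalgebra k V)) {i j : V} (p : Quiver.Path i j) :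
    (F * G) (ofPath k ⟨p⟩) =
      ((splits p).map fun t => F (ofPath k ⟨t.2.1⟩) * G (ofPath k ⟨t.2.2⟩)).sum := by
  rw [LinearMap.convMul_apply]
  have h : Coalgebra.comul (R := k) (ofPath k (QPath.mk p)) = comulPath k ⟨p⟩ :=
    pathComul_ofPath k _
  rw [h, comulPath, map_list_sum, map_list_sum]
  rfl

theorem conv_ofPath_eq_single (F G : DualAlg k (PathCoalgebra k V)) {i j m : V}
    (x : Quiver.Path i m) (y : Quiver.Path m j)
    (h : ∀ (m' : V) (x' : Quiver.Path i m') (y' : Quiver.Path m' j), x'.comp y' = x.comp y →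
      (F (ofPath k ⟨x'⟩) ≠ 0 ∧ G (ofPath k ⟨y'⟩) ≠ 0) →
      (⟨m', x', y'⟩ : Σ m : V, Quiver.Path i m × Quiver.Path m j) = ⟨m, x, y⟩) :
    (F * G) (ofPath k ⟨x.comp y⟩) = F (ofPath k ⟨x⟩) * G (ofPath k ⟨y⟩) := by
  classical
  rw [conv_ofPath, List.sum_map_eq_nsmul_single
    (⟨m, x, y⟩ : Σ m : V, Quiver.Path i m × Quiver.Path m j),
    List.count_eq_one_of_mem (nodup_splits _) ((mem_splits _ _).mpr rfl), one_smul]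
  rintro ⟨m', x', y'⟩ hne ht
  by_contra h0
  exact hne (h m' x' y' ((mem_splits _ _).mp ht) (mul_ne_zero_iff.mp h0))

theorem conv_ofPath_of_left {F : DualAlg k (PathCoalgebra k V)}
    (hF : ∀ p : QPath V, 0 < p.length → F (ofPath k p) = 0) (G : DualAlg k (PathCoalgebra k V))
    {i j : V} (p : Quiver.Path i j) :
    (F * G) (ofPath k ⟨p⟩) = F (ofPath k (QPath.triv i)) * G (ofPath k ⟨p⟩) := by
  have h := conv_ofPath_eq_single F G (Quiver.Path.nil (a := i)) p
  rw [Quiver.Path.nil_comp] at h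
  refine h fun m' x' y' hxy h0 => ?_
  cases x' with
  | nil =>
    rw [Quiver.Path.nil_comp] at hxy
    rw [hxy]
  | cons x' a => exact absurd (hF ⟨x'.cons a⟩ (Nat.succ_pos _)) h0.1

theorem conv_ofPath_of_right (F : DualAlg k (PathCoalgebra k V))
    {G : DualAlg k (PathCoalgebra k V)} (hG : ∀ p : QPath V, 0 < p.length → G (ofPath k p) = 0)
    {i j : V} (p : Quiver.Path i j) :
    (F * G) (ofPath k ⟨p⟩) = F (ofPath k ⟨p⟩) * G (ofPath k (QPath.triv j)) := by
  have h := conv_ofPath_eq_single F G p Quiver.Path.nil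
  rw [Quiver.Path.comp_nil] at h
  refine h fun m' x' y' hxy h0 => ?_
  cases y' with
  | nil =>
    rw [Quiver.Path.comp_nil] at hxy
    rw [hxy]
  | cons y' a => exact absurd (hG ⟨y'.cons a⟩ (Nat.succ_pos _)) h0.2

theorem conv_ofPath_cons (F : DualAlg k (PathCoalgebra k V))
    {G : DualAlg k (PathCoalgebra k V)} (hG : ∀ p : QPath V, p.length ≠ 1 → G (ofPath k p) = 0)
    {i j m : V} (p : Quiver.Path i m) (b : m ⟶ j) :
    (F * G) (ofPath k ⟨p.cons b⟩) = F (ofPath k ⟨p⟩) * G (ofPath k ⟨b.toPath⟩) := by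
  refine conv_ofPath_eq_single F G p b.toPath fun m' x' y' hxy h0 => ?_
  have hl : y'.length = 1 := by
    by_contra hl
    exact h0.2 (hG ⟨y'⟩ hl)
  cases y' with
  | nil => simp at hl
  | cons y' a =>
    cases y' with
    | nil =>
      cases hxy
      rfl
    | cons y' a' => simp at hl

/-! ### The filtration by length -/

/-- The functional `F` vanishes on all paths of length less than `n`. -/
def VanishesBelow (n : ℕ) (F : DualAlg k (PathCoalgebra k V)) : Prop :=
  ∀ p : QPath V, p.length < n → F (ofPath k p) = 0

theorem VanishesBelow.mul {m n : ℕ} {F G : DualAlg k (PathCoalgebra k V)}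
    (hF : VanishesBelow m F) (hG : VanishesBelow n G) : VanishesBelow (m + n) (F * G) := by
  rintro ⟨p⟩ hp
  rw [conv_ofPath]
  apply List.sum_eq_zero
  intro x hx
  rw [List.mem_map] at hx
  obtain ⟨t, ht, rfl⟩ := hx
  rw [mem_splits] at ht
  have hl : t.2.1.length + t.2.2.length < m + n := by
    rw [← Quiver.Path.length_comp, ht]
    exact hp
  by_cases h0 : t.2.1.length < m
  · rw [hF ⟨t.2.1⟩ h0, zero_mul]
  · rw [hG ⟨t.2.2⟩ (by change t.2.2.length < n; omega), mul_zero]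

theorem vanishesBelow_zero (F : DualAlg k (PathCoalgebra k V)) : VanishesBelow 0 F :=
  fun _ hp => absurd hp (Nat.not_lt_zero _)

theorem VanishesBelow.pow {F : DualAlg k (PathCoalgebra k V)} (hF : VanishesBelow 1 F) (n : ℕ) :
    VanishesBelow n (F ^ n) := by
  induction n with
  | zero => exact vanishesBelow_zero _
  | succ n ih =>
    rw [pow_succ]
    exact ih.mul hF

/-- The inverse is the geometric series, which is finite on each path. -/
theorem VanishesBelow.exists_mul_one_sub {F : DualAlg k (PathCoalgebra k V)}
    (hF : VanishesBelow 1 F) : ∃ G, G * (1 - F) = 1 := by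
  refine ⟨pathFunctional fun p => (∑ m ∈ Finset.range (p.length + 1), F ^ m) (ofPath k p), ?_⟩
  set G := pathFunctional fun p : QPath V =>
    (∑ m ∈ Finset.range (p.length + 1), F ^ m) (ofPath k p) with hG
  have key : ∀ n, VanishesBelow n (G - ∑ m ∈ Finset.range n, F ^ m) := by
    intro n q hq
    change G (ofPath k q) - (∑ m ∈ Finset.range n, F ^ m) (ofPath k q) = 0
    rw [hG, pathFunctional_ofPath, dualAlg_sum_apply, dualAlg_sum_apply, sub_eq_zero]
    refine Finset.sum_subset (Finset.range_subset_range.mpr hq) fun m _ hm => ?_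
    rw [Finset.mem_range, not_lt] at hm
    exact hF.pow m q hm
  apply dual_ext_path
  intro p
  have h1 := (key (p.length + 1)).mul (vanishesBelow_zero (1 - F)) p (Nat.lt_succ_self _)
  have h2 := hF.pow (p.length + 1) p (Nat.lt_succ_self _)
  rw [sub_mul, geom_sum_mul_neg] at h1
  change (G * (1 - F)) (ofPath k p) - ((1 : DualAlg k (PathCoalgebra k V)) (ofPath k p) -
    (F ^ (p.length + 1)) (ofPath k p)) = 0 at h1
  rwa [h2, sub_zero, sub_eq_zero] at h1

theorem mem_lengthSpan_iff {s : Set ℕ} {x : PathCoalgebra k V} :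
    x ∈ lengthSpan k V s ↔ ∀ p : QPath V, p.length ∉ s → coeff p x = 0 := by
  have h : lengthSpan k V s = Finsupp.supported k k {p : QPath V | p.length ∈ s} :=
    (Finsupp.supported_eq_span_single k _).symm
  rw [h]
  constructor
  · intro hx p hp
    exact Finsupp.notMem_support_iff.mp fun hp' => hp (hx hp')
  · intro hx p hp
    by_contra hp'
    exact (Finsupp.mem_support_iff.mp hp) (hx p hp')

theorem vanishesBelow_iff {n : ℕ} {F : DualAlg k (PathCoalgebra k V)} :
    VanishesBelow n F ↔ ∀ x ∈ lengthSpan k V (Set.Iio n), F x = 0 := by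
  refine ⟨fun h x hx => ?_, fun h p hp => h _ (Submodule.subset_span ⟨p, hp, rfl⟩)⟩
  have hle : lengthSpan k V (Set.Iio n) ≤ LinearMap.ker F.ofConv := by
    rw [lengthSpan, Submodule.span_le]
    rintro _ ⟨p, hp, rfl⟩
    exact h p hp
  exact hle hx

/-! ### Arrows -/

variable (V) in
/-- The arrows of the quiver. -/
abbrev Arrow : Type (max v w) := Σ i j : V, (i ⟶ j)

/-- An arrow as a path of length one. -/
def Arrow.toQPath (a : Arrow V) : QPath V := ⟨a.2.2.toPath⟩

theorem Arrow.toQPath_injective : Function.Injective (Arrow.toQPath (V := V)) := by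
  rintro ⟨i, j, a⟩ ⟨i', j', a'⟩ h
  cases h
  rfl

open Classical in
/-- The functional `p ↦ F(p a)`, where `F(p a)` is read as `0` if `p` does not end at the source
of the arrow `a`. -/
def rightTranslate (F : DualAlg k (PathCoalgebra k V)) (a : Arrow V) :
    DualAlg k (PathCoalgebra k V) :=
  pathFunctional fun p =>
    if h : p.tgt = a.1 then F (ofPath k ⟨(p.path.cast rfl h).cons a.2.2⟩) else 0

theorem rightTranslate_ofPath (F : DualAlg k (PathCoalgebra k V)) {i m j : V}
    (p : Quiver.Path i m) (a : m ⟶ j) :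
    rightTranslate F ⟨m, j, a⟩ (ofPath k ⟨p⟩) = F (ofPath k ⟨p.cons a⟩) := by
  rw [rightTranslate, pathFunctional_ofPath]
  exact dif_pos rfl

theorem VanishesBelow.rightTranslate {n : ℕ} {F : DualAlg k (PathCoalgebra k V)}
    (hF : VanishesBelow (n + 1) F) (a : Arrow V) : VanishesBelow n (rightTranslate F a) := by
  obtain ⟨m, j, a⟩ := a
  rintro ⟨p⟩ hp
  rw [PathCoalg.rightTranslate, pathFunctional_ofPath]
  split_ifs with h
  · cases h
    exact hF _ (Nat.succ_lt_succ hp)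
  · rfl

/-- The coefficient of an arrow, as an element of the complete path algebra. -/
def arrowCoeff (a : Arrow V) : DualAlg k (PathCoalgebra k V) := WithConv.toConv (coeff a.toQPath)

theorem arrowCoeff_ofPath [DecidableEq (QPath V)] (a : Arrow V) (p : QPath V) :
    arrowCoeff a (ofPath k p) = if p = a.toQPath then (1 : k) else 0 :=
  coeff_ofPath k _ _

theorem arrowCoeff_of_length_ne (a : Arrow V) {p : QPath V} (hp : p.length ≠ 1) :
    arrowCoeff a (ofPath k p) = 0 := by
  classical
  rw [arrowCoeff_ofPath, if_neg]
  rintro rfl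
  exact hp rfl

/-- A functional that vanishes on the trivial paths lies in the right span of the arrows. -/
theorem VanishesBelow.eq_sum_arrows [Fintype (Arrow V)] {F : DualAlg k (PathCoalgebra k V)}
    (hF : VanishesBelow 1 F) :
    F = ∑ a : Arrow V, PathCoalg.rightTranslate F a * arrowCoeff a := by
  classical
  apply dual_ext_path
  rintro ⟨p⟩
  rw [dualAlg_sum_apply]
  cases p with
  | nil =>
    rename_i i
    refine (hF (QPath.triv i) Nat.zero_lt_one).trans (Finset.sum_eq_zero ?_).symm
    intro a _
    have h : VanishesBelow 1 (arrowCoeff (k := k) a) := fun p hp =>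
      arrowCoeff_of_length_ne a hp.ne
    exact (vanishesBelow_zero (PathCoalg.rightTranslate F a)).mul h _ (Nat.lt_succ_self 0)
  | @cons m _ p b =>
    rename_i i j
    have h : ∀ a : Arrow V, (PathCoalg.rightTranslate F a * arrowCoeff a :
        DualAlg k (PathCoalgebra k V)) (ofPath k ⟨p.cons b⟩) =
        if a = ⟨m, j, b⟩ then F (ofPath k ⟨p.cons b⟩) else 0 := by
      intro a
      rw [conv_ofPath_cons _ fun p hp => arrowCoeff_of_length_ne a hp, arrowCoeff_ofPath]
      by_cases ha : a = ⟨m, j, b⟩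
      · subst ha
        have hb : Arrow.toQPath ⟨m, j, b⟩ = ⟨b.toPath⟩ := rfl
        rw [if_pos rfl, hb, if_pos rfl, mul_one, rightTranslate_ofPath]
      · rw [if_neg ha, if_neg, mul_zero]
        exact fun h => ha (Arrow.toQPath_injective (a₁ := ⟨m, j, b⟩) h).symm
    rw [Finset.sum_congr rfl fun a _ => h a, Finset.sum_ite_eq' Finset.univ,
      if_pos (Finset.mem_univ _)]

theorem finite_paths_length_eq [Finite V] [∀ i j : V, Finite (i ⟶ j)] (n : ℕ) :
    {p : QPath V | p.length = n}.Finite := by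
  induction n with
  | zero =>
    refine (Set.finite_range (QPath.triv (V := V))).subset ?_
    rintro ⟨p⟩ hp
    cases p with
    | nil => exact ⟨_, rfl⟩
    | cons p a => exact absurd hp (Nat.succ_ne_zero _)
  | succ n ih =>
    have := ih.to_subtype
    refine (Set.finite_range fun t : (Σ (p : {p : QPath V | p.length = n}) (j : V),
      (p.1.tgt ⟶ j)) => QPath.mk (t.1.1.path.cons t.2.2)).subset ?_
    rintro ⟨p⟩ hp
    cases p with
    | nil => exact absurd hp.symm (Nat.succ_ne_zero _)
    | cons p a => exact ⟨⟨⟨⟨p⟩, Nat.succ.inj hp⟩, _, a⟩, rfl⟩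

instance finiteDimensional_lengthSpan [Finite V] [∀ i j : V, Finite (i ⟶ j)] (n : ℕ) :
    FiniteDimensional k (lengthSpan k V (Set.Iio n)) := by
  refine FiniteDimensional.span_of_finite k (Set.Finite.image _ ?_)
  have h : {p : QPath V | p.length ∈ Set.Iio n} = ⋃ m ∈ Set.Iio n, {p : QPath V | p.length = m} := by
    ext p
    simp
  rw [h]
  exact (Set.finite_Iio n).biUnion fun m _ => finite_paths_length_eq m

/-! ### The degree zero part -/

/-- The functional with value `u i` on the trivial path at `i` and `0` on the nontrivial paths. -/
def diagFunctional (u : V → k) : DualAlg k (PathCoalgebra k V) :=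
  pathFunctional fun p => if p.length = 0 then u p.src else 0

theorem diagFunctional_triv (u : V → k) (i : V) :
    diagFunctional u (ofPath k (QPath.triv i)) = u i := by
  rw [diagFunctional, pathFunctional_ofPath]
  exact if_pos rfl

theorem diagFunctional_of_length_pos (u : V → k) (p : QPath V) (hp : 0 < p.length) :
    diagFunctional u (ofPath k p) = 0 := by
  rw [diagFunctional, pathFunctional_ofPath, if_neg hp.ne']

theorem diagFunctional_mul (u : V → k) (F : DualAlg k (PathCoalgebra k V)) {i j : V}
    (p : Quiver.Path i j) : (diagFunctional u * F) (ofPath k ⟨p⟩) = u i * F (ofPath k ⟨p⟩) := by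
  rw [conv_ofPath_of_left (diagFunctional_of_length_pos u), diagFunctional_triv]

theorem mul_diagFunctional (F : DualAlg k (PathCoalgebra k V)) (u : V → k) {i j : V}
    (p : Quiver.Path i j) : (F * diagFunctional u) (ofPath k ⟨p⟩) = F (ofPath k ⟨p⟩) * u j := by
  rw [conv_ofPath_of_right _ (diagFunctional_of_length_pos u), diagFunctional_triv]

variable (k V) in
/-- The embedding of `k^V` into the complete path algebra as its degree zero part. -/
def diagHom : (V → k) →ₐ[k] DualAlg k (PathCoalgebra k V) :=
  AlgHom.ofLinearMap
    { toFun := diagFunctional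
      map_add' := fun u u' => dual_ext_path fun p => by
        change _ = diagFunctional u (ofPath k p) + diagFunctional u' (ofPath k p)
        simp only [diagFunctional, pathFunctional_ofPath]
        split_ifs <;> simp
      map_smul' := fun c u => dual_ext_path fun p => by
        change _ = c • diagFunctional u (ofPath k p)
        simp only [diagFunctional, pathFunctional_ofPath]
        split_ifs <;> simp }
    (dual_ext_path fun p => by
      change diagFunctional 1 (ofPath k p) = pathCounit k (ofPath k p)
      rw [diagFunctional, pathFunctional_ofPath, pathCounit_ofPath]
      rfl)
    (fun u u' => dual_ext_path fun ⟨p⟩ => by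
      change diagFunctional (u * u') _ = (diagFunctional u * diagFunctional u') _
      rw [diagFunctional_mul, diagFunctional, diagFunctional, pathFunctional_ofPath,
        pathFunctional_ofPath]
      split_ifs <;> simp)

theorem diagHom_range : (diagHom k V).range = degZero k V := by
  apply le_antisymm
  · rintro _ ⟨u, rfl⟩ p hp
    exact diagFunctional_of_length_pos u p hp
  · intro F hF
    refine ⟨fun i => F (ofPath k (QPath.triv i)), dual_ext_path ?_⟩
    rintro ⟨p⟩
    change diagFunctional _ _ = _
    cases p with
    | nil => exact diagFunctional_triv _ _
    | cons p a =>
      rw [hF ⟨p.cons a⟩ (Nat.succ_pos _)]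
      exact diagFunctional_of_length_pos _ _ (Nat.succ_pos _)

theorem diagHom_single [DecidableEq V] (i : V) : diagHom k V (Pi.single i 1) = idem i := by
  classical
  refine dual_ext_path ?_
  rintro @⟨j, _, p⟩
  refine Eq.trans ?_ (coeff_ofPath k _ _).symm
  cases p with
  | nil =>
    refine (diagFunctional_triv _ _).trans ?_
    by_cases hj : j = i
    · subst hj
      rw [Pi.single_eq_same]
      exact (if_pos rfl).symm
    · rw [Pi.single_eq_of_ne hj, if_neg]
      exact fun h => hj (congrArg QPath.src h)
  | cons p a =>
    refine (diagFunctional_of_length_pos _ ⟨p.cons a⟩ (Nat.succ_pos _)).trans (if_neg ?_).symm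
    exact fun h => absurd (congrArg QPath.length h) (Nat.succ_ne_zero _)

end PathAlgebra

/-! ### Group-like elements and simple subcoalgebras -/

section Subcoalgebras

variable {k : Type u} [Field k] {C : Type v} [AddCommGroup C] [Module k C] [Coalgebra k C]

/-- The line spanned by a group-like element, as a subcoalgebra. -/
def groupLikeSubcoalgebra {x : C} (hx : IsGroupLikeElem k x) : Subcoalgebra k C where
  toSubmodule := Submodule.span k {x}
  comul_mem' := by
    intro y hy
    obtain ⟨c, rfl⟩ := Submodule.mem_span_singleton.mp hy
    rw [map_smul, hx.comul_eq_tmul_self]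
    have hx' : x ∈ Submodule.span k {x} := Submodule.mem_span_singleton_self x
    exact Submodule.smul_mem _ c ⟨(⟨x, hx'⟩ : Submodule.span k {x}) ⊗ₜ ⟨x, hx'⟩, rfl⟩

theorem groupLikeSubcoalgebra_isSimple {x : C} (hx : IsGroupLikeElem k x) :
    (groupLikeSubcoalgebra hx).IsSimple := by
  have hx0 : x ≠ 0 := hx.ne_zero
  refine ⟨fun h => hx0 (Submodule.span_singleton_eq_bot.mp h), fun T hT => ?_⟩
  exact (nonzero_span_atom x hx0).le_iff.mp hT

theorem mem_coradical_of_isGroupLikeElem {x : C} (hx : IsGroupLikeElem k x) :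
    x ∈ coradical k C :=
  (le_iSup₂_of_le (f := fun (S : Subcoalgebra k C) (_ : S.IsSimple) => S.toSubmodule)
    (groupLikeSubcoalgebra hx) (groupLikeSubcoalgebra_isSimple hx) le_rfl)
    (Submodule.mem_span_singleton_self x)

/-- If `y = x₁ g(x₂)`, as tested against all functionals, and `x` lies in a subcoalgebra, then so
does `y`. -/
theorem Subcoalgebra.mem_of_forall_mul_apply_eq (S : Subcoalgebra k C) {x y : C}
    (hx : x ∈ S.toSubmodule) (g : DualAlg k C) (h : ∀ f : DualAlg k C, (f * g) x = f y) :
    y ∈ S.toSubmodule := by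
  let T : C ⊗[k] C →ₗ[k] C := (TensorProduct.rid k C).toLinearMap ∘ₗ g.ofConv.lTensor C
  have hT : ∀ (f : C →ₗ[k] k) z,
      f (T z) = LinearMap.mul' k k (TensorProduct.map f g.ofConv z) := by
    intro f z
    induction z with
    | zero => simp
    | add a b ha hb => simp only [map_add, ha, hb]
    | tmul a b => simp [T, mul_comm]
  have hy : y = T (Coalgebra.comul (R := k) x) := eq_of_forall_dual_apply_eq (k := k) fun f => by
    rw [hT]
    exact (h (WithConv.toConv f)).symm
  obtain ⟨z, hz⟩ := S.comul_mem' x hx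
  rw [hy, ← hz]
  clear hz
  induction z with
  | zero => simp
  | add a b ha hb =>
    rw [map_add, map_add]
    exact add_mem ha hb
  | tmul a b =>
    have : T (TensorProduct.map S.toSubmodule.subtype S.toSubmodule.subtype (a ⊗ₜ b)) =
        g (b : C) • (a : C) := by simp [T]
    rw [this]
    exact Submodule.smul_mem _ _ a.2

theorem Subcoalgebra.isGroupLikeElem_of_coe (S : Subcoalgebra k C) {x : S.Carrier}
    (hx : IsGroupLikeElem k (x : C)) : IsGroupLikeElem k x where
  counit_eq_one := hx.counit_eq_one
  comul_eq_tmul_self :=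
    map_subtype_injective S.toSubmodule ((S.map_comul x).trans hx.comul_eq_tmul_self)

end Subcoalgebras

/-! ### Large subcoalgebras of the path coalgebra -/

section Large

variable {k : Type u} [Field k] {V : Type v} [Quiver.{w} V]

theorem isGroupLikeElem_triv (i : V) : IsGroupLikeElem k (ofPath k (QPath.triv i)) where
  counit_eq_one := (pathCounit_ofPath k _).trans (if_pos rfl)
  comul_eq_tmul_self := by
    refine (pathComul_ofPath k _).trans ?_
    simp [comulPath, QPath.triv, splits]

theorem conv_arrow (F G : DualAlg k (PathCoalgebra k V)) {i j : V} (a : i ⟶ j) :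
    (F * G) (ofPath k ⟨a.toPath⟩) = F (ofPath k ⟨a.toPath⟩) * G (ofPath k (QPath.triv j)) +
      F (ofPath k (QPath.triv i)) * G (ofPath k ⟨a.toPath⟩) := by
  rw [conv_ofPath]
  simp [splits, Quiver.Hom.toPath, QPath.triv]

/-- If `x` has no path longer than `p`, then `x₁ p(x₂)`, tested against a functional `F`, is the
coefficient of `p` in `x` times the trivial path at the source of `p`. -/
theorem mul_coeff_apply {p : QPath V} {x : PathCoalgebra k V}
    (hx : x ∈ lengthSpan k V (Set.Iio (p.length + 1))) (F : DualAlg k (PathCoalgebra k V)) :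
    (F * WithConv.toConv (coeff p) : DualAlg k (PathCoalgebra k V)) x =
      coeff p x * F (ofPath k (QPath.triv p.src)) := by
  classical
  obtain ⟨p⟩ := p
  rename_i i j
  set P : DualAlg k (PathCoalgebra k V) := WithConv.toConv (coeff ⟨p⟩) with hP
  have hPv : ∀ q, P (ofPath k q) = if q = ⟨p⟩ then (1 : k) else 0 := fun q => coeff_ofPath k _ q
  have key : VanishesBelow (p.length + 1) (F * P - F (ofPath k (QPath.triv i)) • P) := by
    rintro ⟨q⟩ hq
    change (F * P) (ofPath k _) - F (ofPath k (QPath.triv i)) * P (ofPath k _) = 0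
    have hsplit : ∀ {m i' j' : V} (x' : Quiver.Path i' m) (y' : Quiver.Path m j'),
        x'.length + y'.length < p.length + 1 → P (ofPath k ⟨y'⟩) ≠ 0 → x'.length = 0 := by
      intro m i' j' x' y' hl h0
      rw [hPv] at h0
      have h1 : QPath.mk y' = ⟨p⟩ := by
        by_contra h
        exact h0 (if_neg h)
      have h2 : y'.length = p.length := congrArg QPath.length h1
      omega
    rename_i i' j'
    have h := conv_ofPath_eq_single F P (Quiver.Path.nil (a := i')) q
    rw [Quiver.Path.nil_comp] at h
    rw [h, hPv]
    · split_ifs with hqp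
      · cases hqp
        exact sub_self _
      · rw [mul_zero, mul_zero, sub_zero]
    · intro m' x' y' hxy h0
      have hl : x'.length = 0 := by
        refine hsplit x' y' ?_ h0.2
        rw [← Quiver.Path.length_comp, hxy]
        exact hq
      cases x' with
      | nil =>
        rw [Quiver.Path.nil_comp] at hxy
        rw [hxy]
      | cons x' a => exact absurd hl (Nat.succ_ne_zero _)
  have h := vanishesBelow_iff.mp key x hx
  rw [mul_comm]
  exact sub_eq_zero.mp h

theorem exists_mem_lengthSpan (x : PathCoalgebra k V) : ∃ n, x ∈ lengthSpan k V (Set.Iio n) := by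
  obtain ⟨n, hn⟩ := (Finset.image QPath.length (Finsupp.support x)).bddAbove
  refine ⟨n + 1, mem_lengthSpan_iff.mpr fun p hp => ?_⟩
  by_contra h
  refine hp (Nat.lt_succ_of_le (hn ?_))
  exact Finset.mem_image_of_mem _ (Finsupp.mem_support_iff.mpr h)

/-- A nonzero element has a longest path. -/
theorem exists_longest_path {x : PathCoalgebra k V} (hx : x ≠ 0) :
    ∃ p : QPath V, coeff p x ≠ 0 ∧ x ∈ lengthSpan k V (Set.Iio (p.length + 1)) := by
  obtain ⟨p, hp, hmax⟩ := Finset.exists_max_image (Finsupp.support x) QPath.length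
    (Finsupp.support_nonempty_iff.mpr hx)
  refine ⟨p, Finsupp.mem_support_iff.mp hp, mem_lengthSpan_iff.mpr fun q hq => ?_⟩
  by_contra h
  exact hq (Nat.lt_succ_of_le (hmax q (Finsupp.mem_support_iff.mpr h)))

variable {D : Subcoalgebra k (PathCoalgebra k V)}

/-- A trivial path as an element of a large subcoalgebra. -/
def vertex (hD : IsLarge D) (i : V) : D.Carrier :=
  ⟨ofPath k (QPath.triv i), hD (Submodule.subset_span ⟨_, Nat.zero_le 1, rfl⟩)⟩

theorem isGroupLikeElem_vertex (hD : IsLarge D) (i : V) : IsGroupLikeElem k (vertex hD i) :=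
  D.isGroupLikeElem_of_coe (isGroupLikeElem_triv i)

/-- The coradical is spanned by the trivial paths: a simple subcoalgebra contains, with a nonzero
element, the source of a longest path of that element. -/
theorem coradical_eq_span (hD : IsLarge D) :
    coradical k D.Carrier = Submodule.span k (Set.range (vertex hD)) := by
  apply le_antisymm
  · refine iSup₂_le fun S hS => ?_
    obtain ⟨x, hxS, hx⟩ := (Submodule.ne_bot_iff _).mp hS.1
    obtain ⟨p, hp, hxp⟩ := exists_longest_path (k := k) fun h => hx (Subtype.ext h)
    have hmem : coeff p x.1 • vertex hD p.src ∈ S.toSubmodule := by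
      refine S.mem_of_forall_mul_apply_eq hxS (D.res (WithConv.toConv (coeff p))) fun f => ?_
      obtain ⟨F, rfl⟩ := D.res_surjective f
      rw [← map_mul, map_smul]
      exact mul_coeff_apply hxp F
    have hv : vertex hD p.src ∈ S.toSubmodule := (Submodule.smul_mem_iff _ hp).mp hmem
    have hG := isGroupLikeElem_vertex hD p.src
    have hle : Submodule.span k {vertex hD p.src} ≤ S.toSubmodule := by
      rwa [Submodule.span_singleton_le_iff_mem]
    rcases hS.2 (groupLikeSubcoalgebra hG) hle with h | h
    · exact absurd h (groupLikeSubcoalgebra_isSimple hG).1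
    · rw [← h]
      exact Submodule.span_mono (Set.singleton_subset_iff.mpr ⟨_, rfl⟩)
  · rw [Submodule.span_le]
    rintro _ ⟨i, rfl⟩
    exact mem_coradical_of_isGroupLikeElem (isGroupLikeElem_vertex hD i)

theorem mem_coalgAutZero_iff (hD : IsLarge D) (σ : D.Carrier ≃ₗc[k] D.Carrier) :
    σ ∈ coalgAutZero D ↔ ∀ i, σ (vertex hD i) = vertex hD i := by
  refine ⟨fun h i => h _ (mem_coradical_of_isGroupLikeElem (isGroupLikeElem_vertex hD i)),
    fun h x hx => ?_⟩
  rw [coradical_eq_span hD] at hx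
  induction hx using Submodule.span_induction with
  | mem x hx =>
    obtain ⟨i, rfl⟩ := hx
    exact h i
  | zero => exact map_zero σ
  | add x y _ _ hx hy => rw [map_add, hx, hy]
  | smul c x _ hx => rw [map_smul, hx]

/-! ### The radical of the dual algebra -/

theorem exists_vanishesBelow_one_of_vertex (hD : IsLarge D) {f : BAlg D}
    (hf : ∀ i, f (vertex hD i) = 0) : ∃ F, VanishesBelow 1 F ∧ D.res F = f := by
  obtain ⟨F, rfl⟩ := D.res_surjective f
  refine ⟨F, ?_, rfl⟩
  rintro ⟨p⟩ hp
  cases p with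
  | nil => exact hf _
  | cons p a => exact absurd hp (Nat.not_lt.mpr (Nat.succ_le_succ (Nat.zero_le _)))

/-- The radical of `D^*` is the annihilator of the coradical of `D`. -/
theorem mem_jacobson_iff_vertex (hD : IsLarge D) (f : BAlg D) :
    f ∈ Ring.jacobson (BAlg D) ↔ ∀ i, f (vertex hD i) = 0 := by
  refine ⟨fun hf i => jacobson_apply_eq_zero (isGroupLikeElem_vertex hD i) hf, fun hf => ?_⟩
  rw [← Ideal.jacobson_bot, Ideal.mem_jacobson_iff]
  intro y
  obtain ⟨F, hF, hFy⟩ := exists_vanishesBelow_one_of_vertex hD (f := -(y * f)) fun i => by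
    have h := map_mul (evalGroupLike (isGroupLikeElem_vertex hD i)) y f
    change (y * f) (vertex hD i) = y (vertex hD i) * f (vertex hD i) at h
    change -((y * f) (vertex hD i)) = 0
    rw [h, hf, mul_zero, neg_zero]
  obtain ⟨G, hG⟩ := hF.exists_mul_one_sub
  refine ⟨D.res G, ?_⟩
  have h := congrArg D.res hG
  rw [map_mul, map_sub, map_one, hFy, sub_neg_eq_add, mul_add, mul_one, ← mul_assoc] at h
  rw [Ideal.mem_bot, add_comm, h, sub_self]

/-- The splitting `D^* = k^V ⊕ rad(D^*)` for a large subcoalgebra `D` of the path coalgebra. -/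
def radicalSplitting (hD : IsLarge D) : RadicalSplitting k V (BAlg D) where
  proj := AlgHom.pi fun i => evalGroupLike (isGroupLikeElem_vertex hD i)
  lift := D.res.comp (diagHom k V)
  proj_lift u := funext fun i => diagFunctional_triv u i
  mem_jacobson_iff f := (mem_jacobson_iff_vertex hD f).trans funext_iff.symm

theorem proj_apply (hD : IsLarge D) (f : BAlg D) (i : V) :
    (radicalSplitting hD).proj f i = f (vertex hD i) := rfl

theorem radicalSplitting_lift_range (hD : IsLarge D) :
    (radicalSplitting hD).lift.range = bZero D := by
  rw [bZero, ← diagHom_range]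
  exact AlgHom.range_comp _ _

theorem radicalSplitting_e [DecidableEq V] (hD : IsLarge D) (i : V) :
    (radicalSplitting hD).e i = D.res (idem i) :=
  congrArg D.res (diagHom_single i)

theorem autZero_eq [DecidableEq V] (hD : IsLarge D) :
    autZero D = autModRad (radicalSplitting hD).e := by
  rw [autZero]
  congr 1
  exact funext fun i => (radicalSplitting_e hD i).symm

/-- A central element takes the same value at the two ends of each arrow, so that its degree zero
part is central. -/
theorem lift_proj_commute (hD : IsLarge D) (z : BAlg D) (hz : ∀ x, Commute z x) (x : BAlg D) :
    Commute ((radicalSplitting hD).lift ((radicalSplitting hD).proj z)) x := by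
  classical
  obtain ⟨Z, rfl⟩ := D.res_surjective z
  obtain ⟨F, rfl⟩ := D.res_surjective x
  set u := (radicalSplitting hD).proj (D.res Z) with hu
  have harrow : ∀ {i j : V} (a : i ⟶ j), u i = u j := by
    intro i j a
    have hmem : ofPath k (QPath.mk a.toPath) ∈ D.toSubmodule :=
      hD (Submodule.subset_span ⟨⟨a.toPath⟩, le_refl 1, rfl⟩)
    have h1 : (Z * arrowCoeff ⟨i, j, a⟩ : DualAlg k (PathCoalgebra k V)) (ofPath k ⟨a.toPath⟩) =
        (arrowCoeff ⟨i, j, a⟩ * Z : DualAlg k (PathCoalgebra k V)) (ofPath k ⟨a.toPath⟩) := by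
      have h2 := congrArg (fun l : BAlg D => l ⟨_, hmem⟩) (hz (D.res (arrowCoeff ⟨i, j, a⟩))).eq
      rwa [← map_mul, ← map_mul] at h2
    have h0 : ∀ l : V, arrowCoeff (k := k) ⟨i, j, a⟩ (ofPath k (QPath.triv l)) = 0 := fun l =>
      arrowCoeff_of_length_ne _ Nat.zero_ne_one
    have h3 : arrowCoeff (k := k) ⟨i, j, a⟩ (ofPath k ⟨a.toPath⟩) = 1 := by
      rw [arrowCoeff_ofPath]
      exact if_pos rfl
    rw [conv_arrow, conv_arrow, h0, h0, h3, mul_zero, zero_add, mul_one, zero_mul, add_zero,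
      one_mul] at h1
    exact h1
  have hpath : ∀ {i j : V} (_ : Quiver.Path i j), u i = u j := by
    intro i j p
    induction p with
    | nil => rfl
    | cons p a ih => exact ih.trans (harrow a)
  have h : diagFunctional u * F = F * diagFunctional u := by
    refine dual_ext_path ?_
    rintro ⟨p⟩
    rw [diagFunctional_mul, mul_diagFunctional, hpath p, mul_comm]
  change D.res (diagFunctional u) * D.res F = D.res F * D.res (diagFunctional u)
  rw [← map_mul, h, map_mul]

/-! ### Automorphisms of the dual algebra come from the coalgebra -/

section Continuity

variable [Finite V] [∀ i j : V, Finite (i ⟶ j)]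

/-- Automorphisms of `D^*` preserve the filtration by length: a functional that vanishes below
length `n + 1` is a sum of products of a functional that vanishes below length `n` and an arrow,
and automorphisms preserve the radical. -/
theorem VanishesBelow.exists_map (hD : IsLarge D) (φ : AutB D) {n : ℕ}
    {F : DualAlg k (PathCoalgebra k V)} (hF : VanishesBelow n F) :
    ∃ F', VanishesBelow n F' ∧ D.res F' = φ (D.res F) := by
  cases nonempty_fintype (Arrow V)
  induction n generalizing F with
  | zero =>
    obtain ⟨F', hF'⟩ := D.res_surjective (φ (D.res F))
    exact ⟨F', vanishesBelow_zero _, hF'⟩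
  | succ n ih =>
    choose G hG hGF using fun a : Arrow V => ih (hF.rightTranslate a)
    have harrow : ∀ a : Arrow V, ∃ H, VanishesBelow 1 H ∧ D.res H = φ (D.res (arrowCoeff a)) :=
      fun a => exists_vanishesBelow_one_of_vertex hD <| (mem_jacobson_iff_vertex hD _).mp <|
        map_mem_jacobson φ <| (mem_jacobson_iff_vertex hD _).mpr fun i =>
          arrowCoeff_of_length_ne a Nat.zero_ne_one
    choose H hH hHa using harrow
    refine ⟨∑ a, G a * H a, fun p hp => ?_, ?_⟩
    · rw [dualAlg_sum_apply]
      exact Finset.sum_eq_zero fun a _ => (hG a).mul (hH a) p hp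
    · have hF1 : VanishesBelow 1 F := fun p hp => hF p (by omega)
      conv_rhs => rw [hF1.eq_sum_arrows]
      simp only [map_sum, map_mul, hGF, hHa]

theorem exists_forall_apply_eq (hD : IsLarge D) (φ : AutB D) (x : D.Carrier) :
    ∃ y, ∀ f, φ f x = f y := by
  obtain ⟨n, hn⟩ := exists_mem_lengthSpan (x : PathCoalgebra k V)
  let W : Submodule k D.Carrier := (lengthSpan k V (Set.Iio n)).comap D.toSubmodule.subtype
  have hW : FiniteDimensional k W := by
    refine FiniteDimensional.of_injective
      ((D.toSubmodule.subtype ∘ₗ W.subtype).codRestrict (lengthSpan k V (Set.Iio n))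
        fun y => y.2) fun y z h => ?_
    have h' : (y.1.1 : PathCoalgebra k V) = z.1.1 :=
      congrArg (fun t : lengthSpan k V (Set.Iio n) => (t : PathCoalgebra k V)) h
    exact Subtype.ext (Subtype.ext h')
  let l : Module.Dual k D.Carrier →ₗ[k] k :=
    { toFun := fun f => φ (WithConv.toConv f) x
      map_add' := fun f g => by
        rw [WithConv.toConv_add, map_add]
        rfl
      map_smul' := fun c f => by
        rw [WithConv.toConv_smul, map_smul]
        rfl }
  obtain ⟨y, hy⟩ := exists_eq_apply_of_vanishing W l fun f hf => by
    obtain ⟨F, rfl, hF⟩ :=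
      exists_extend_of_vanishing (W := lengthSpan k V (Set.Iio n)) f hf
    obtain ⟨F', hF', hφ⟩ := VanishesBelow.exists_map hD φ
      (F := WithConv.toConv F) (vanishesBelow_iff.mpr hF)
    refine (congrArg (fun g : BAlg D => g x) hφ.symm).trans ?_
    exact vanishesBelow_iff.mp hF' x hn
  exact ⟨y, fun f => hy f.ofConv⟩

theorem dualAut_surjective (hD : IsLarge D) :
    Function.Surjective (dualAut : (D.Carrier ≃ₗc[k] D.Carrier) → AutB D) := fun φ =>
  exists_dualAut_eq φ (exists_forall_apply_eq hD φ) (exists_forall_apply_eq hD φ.symm)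

end Continuity

theorem dualAut_mem_autZero_iff [Finite V] (hD : IsLarge D) (σ : D.Carrier ≃ₗc[k] D.Carrier) :
    dualAut σ ∈ autZero D ↔ σ ∈ coalgAutZero D := by
  classical
  cases nonempty_fintype V
  rw [autZero_eq hD, RadicalSplitting.mem_autModRad_iff, mem_coalgAutZero_iff hD]
  refine ⟨fun h i => eq_of_forall_dual_apply_eq (k := k) fun f => ?_, fun h f => funext fun i => ?_⟩
  · exact congrFun (h (WithConv.toConv f)) i
  · rw [proj_apply, proj_apply, dualAut_apply, h]

theorem mem_plusPart_iff (x : D.Carrier) :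
    x ∈ plusPart D ↔ ∀ i : V, D.res (idem i) x = 0 := by
  refine mem_lengthSpan_iff.trans ⟨fun h i => h _ (Nat.not_le.mpr Nat.zero_lt_one), fun h => ?_⟩
  rintro ⟨p⟩ hp
  cases p with
  | nil => exact h _
  | cons p a => exact absurd (Nat.succ_le_succ (Nat.zero_le _)) hp

theorem dualAut_mem_autBullet_iff [Finite V] (hD : IsLarge D)
    (σ : D.Carrier ≃ₗc[k] D.Carrier) :
    dualAut σ ∈ autBullet D ↔ σ ∈ coalgAutBullet D := by
  classical
  cases nonempty_fintype V
  have hfix : dualAut σ ∈ autBullet D ↔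
      ∀ i : V, dualAut σ (D.res (idem i)) = D.res (idem i) := by
    rw [autBullet, ← radicalSplitting_lift_range hD, RadicalSplitting.mem_autFixing_iff]
    simp only [radicalSplitting_e]
  constructor
  · intro h
    refine ⟨(dualAut_mem_autZero_iff hD σ).mp ?_, fun x hx => ?_⟩
    · rw [autZero_eq hD]
      refine RadicalSplitting.autFixing_le_autModRad _ ?_
      rwa [radicalSplitting_lift_range]
    · rw [mem_plusPart_iff] at hx ⊢
      intro i
      rw [← dualAut_apply, hfix.mp h, hx]
  · rintro ⟨h0, hplus⟩
    rw [mem_coalgAutZero_iff hD] at h0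
    refine hfix.mpr fun i => WithConv.ext (LinearMap.ext fun x => ?_)
    -- `x` is the sum of its degree zero part `y`, which `σ` fixes, and an element of `D₊`.
    let y : D.Carrier := ∑ j : V, D.res (idem j) x • vertex hD j
    have hy : ∀ l : V, D.res (idem l) y = D.res (idem l) x := by
      intro l
      have hl : ∀ j : V, D.res (idem l) (vertex hD j) = if j = l then (1 : k) else 0 := by
        intro j
        rw [← radicalSplitting_e hD, ← proj_apply, RadicalSplitting.e, RadicalSplitting.proj_lift,
          Pi.single_apply]
      change (D.res (idem l)).ofConv y = _
      simp only [y, map_sum, map_smul, hl, smul_eq_mul, mul_ite, mul_one, mul_zero,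
        Finset.sum_ite_eq', Finset.mem_univ, if_true]
    have hσy : σ y = y := by
      simp only [y, map_sum, map_smul, h0]
    have hxy : x - y ∈ plusPart D := (mem_plusPart_iff _).mpr fun l => by
      rw [map_sub, hy, sub_self]
    have h := (mem_plusPart_iff _).mp (hplus _ hxy) i
    rw [map_sub, map_sub, hσy, hy, sub_eq_zero] at h
    exact h

end Large

end PathCoalg

end

theorem theorem5p15 {k : Type u} [Field k] {V : Type v} [Quiver.{w} V]
    [Finite V] [∀ i j : V, Finite (i ⟶ j)]
    (D : Subcoalgebra k (PathCoalgebra k V)) (hD : IsLarge D) :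
    -- the dual of `Aut₀(D)`
    dualAut '' coalgAutZero D = (autZero D : Set (AutB D)) ∧
    -- the dual of `Aut_•(D)`
    dualAut '' coalgAutBullet D =
      (autBullet D : Set (AutB D)) ∧
    -- inner automorphisms
    ((inn k (BAlg D)).Normal ∧
      (innCirc k (BAlg D)).Normal ∧
      IsInternalSemidirect (inn k (BAlg D)) (innCirc k (BAlg D))
        (innZero D)) ∧
    -- structure of `Aut₀(B)`
    ((autZero D : Set (AutB D)) =
        (innCirc k (BAlg D) : Set (AutB D)) *
          (autBullet D : Set (AutB D)) ∧
      inn k (BAlg D) ⊓ autBullet D = chiCentralizer D ∧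
      (centralizerUnits (bZero D) = unitsOf (bZero D) →
        IsInternalSemidirect (autZero D) (innCirc k (BAlg D)) (autBullet D))) ∧
    -- the exact sequence for `Out(B) = Aut(B)/Inn(B)`
    (∃ (_ : ((chiCentralizer D).subgroupOf (autBullet D)).Normal)
        (_ : (inn k (BAlg D)).Normal)
        (_ : (autZero D).Normal)
        (f : autBullet D ⧸ (chiCentralizer D).subgroupOf (autBullet D) →*
          AutB D ⧸ inn k (BAlg D))
        (g : AutB D ⧸ inn k (BAlg D) →*
          AutB D ⧸ autZero D),
      (∀ σ : autBullet D, f (QuotientGroup.mk σ) =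
        QuotientGroup.mk (σ : AutB D)) ∧
      (∀ σ : AutB D,
        g (QuotientGroup.mk σ) = QuotientGroup.mk σ) ∧
      Function.Injective f ∧ f.range = g.ker ∧ Function.Surjective g) := by
  classical
  cases nonempty_fintype V
  set R := radicalSplitting hD
  have hR : ∀ z : (BAlg D)ˣ, (∀ x : BAlg D, Commute (z : BAlg D) x) →
      ∀ x, Commute (R.lift (R.proj z)) x := fun z hz => lift_proj_commute hD _ hz
  have hB : bZero D = R.lift.range := (radicalSplitting_lift_range hD).symm
  have hbullet : autBullet D = autFixing R.lift.range := by rw [autBullet, hB]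
  have hzero : autZero D = autModRad R.e := autZero_eq hD
  have hcent : inn k (BAlg D) ⊓ autBullet D = chiCentralizer D := inn_inf_autFixing _
  have hmul : (autZero D : Set (AutB D)) =
      (innCirc k (BAlg D) : Set (AutB D)) * (autBullet D : Set (AutB D)) := by
    rw [hzero, hbullet, R.autModRad_eq_mul]
  refine ⟨?_, ?_, ⟨inn_normal, innCirc_normal, ?_⟩, ⟨hmul, hcent, fun hZ => ?_⟩, ?_⟩
  · ext φ
    obtain ⟨σ, rfl⟩ := dualAut_surjective hD φ
    refine ⟨?_, fun h => ⟨σ, (dualAut_mem_autZero_iff hD σ).mp h, rfl⟩⟩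
    rintro ⟨τ, hτ, h⟩
    rw [← h]
    exact (dualAut_mem_autZero_iff hD τ).mpr hτ
  · ext φ
    obtain ⟨σ, rfl⟩ := dualAut_surjective hD φ
    refine ⟨?_, fun h => ⟨σ, (dualAut_mem_autBullet_iff hD σ).mp h, rfl⟩⟩
    rintro ⟨τ, hτ, h⟩
    rw [← h]
    exact (dualAut_mem_autBullet_iff hD τ).mpr hτ
  · rw [innZero, hB]
    exact R.inn_isInternalSemidirect hR
  · rw [hB] at hZ
    rw [hzero, hbullet]
    exact R.autModRad_isInternalSemidirect hR hZ
  · refine exists_exact_quotient inn_normal ?_ ?_ ?_ hcent fun φ hφ => ?_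
    · rw [hzero]
      exact R.autModRad_normal
    · rw [hzero]
      exact R.inn_le_autModRad
    · rw [hzero, hbullet]
      exact R.autFixing_le_autModRad
    · obtain ⟨σ, hσ, τ, hτ, h⟩ := hmul.le hφ
      exact ⟨σ, innCirc_le_inn hσ, τ, hτ, h⟩
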